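/- **Setting.** Let $n\ge 0$ and let $q>0$ be real. A (noncrossing) half-diagram $\mathfrak a$ on the points $1,\dots,n$ is a partition of the points into pairs (arches) and single points (through-strings) such that there are no $i<k<j<l$ with $\{i,j\},\{k,l\}$ paired, and no $i<k<j$ with $\{i,j\}$ paired and $k$ a through-string. $U(n)$ is the complex vector space with basis $\xi_{\mathfrak a}$, $\mathfrak a$ running over the half-diagrams on $n$ points. It carries the form, linear in the first and conjugate linear in the second variable, defined as follows: identify equal points of $\mathfrak a$ and $\mathfrak b$; if some edge path joins two different through-strings of the same diagram, then $\langle\xi_{\mathfrak a},\xi_{\mathfrak b}\rangle=0$; otherwise $\langle\xi_{\mathfrak a},\xi_{\mathfrak b}\rangle=q^c$, where $c$ is the number of closed loops. A noncrossing pairing $\mathfrak p$ of $\{1,\dots,2n\}$ acts on $U(n)$ by concatenation: identify point $2n-j+1$ of $\mathfrak p$ with point $j$ of $\mathfrak a$ for $1\le j\le n$; if an edge path joins two different through-strings of $\mathfrak a$, the result is $0$; otherwise it is $q^c\xi_{\mathfrak b}$, where $c$ is the number of closed loops and $\mathfrak b$ is the half-diagram left on the points $1,\dots,n$ of $\mathfrak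 p$. For $1\le i\le n-1$, $e_i$ denotes the action of the pairing $\{i,i+1\},\{2n-i+1,2n-i\},\{j,2n-j+1\}$ ($j\le n$, $j\ne i,i+1$). The $j$th bracket of $\mathfrak a$ is closing if $j$ is paired with a smaller point, and opening otherwise; $h_i(\mathfrak a)$ is the number of opening minus the number of closing brackets among the first $i$. The restricted sequence $(a_1,\dots,a_m)$ of $\mathfrak a$ is empty if $\mathfrak a$ has no arch; otherwise $a_1$ is the least number such that $\{a_1,a_1+1\}$ is an arch of $\mathfrak a$, and $(a_2,\dots,a_m)$ is the restricted sequence of the half-diagram on $n-2$ points obtained by removing this arch and its two points. If the $i$th bracket of $\mathfrak a$ is closing and the $(i+1)$th is opening ($\mathfrak a$ has a minimum at $i$), then $\Diamond_i(\mathfrak a)$ is the half-diagram whose bracket sequence is that of $\mathfrak a$ with these two brackets interchanged. Let $\Delta_{-1}=0$ and, for $k\ge 0$, let $\Delta_k=\Delta_k(q)$ be the determinant of the $k\times k$ matrix with diagonal entries $q$, entries $1$ directly above and below the diagonal, and $0$ elsewhere. Put $\mu_k=\Delta_{k-1}/\Delta_k$. The vectors $\xi'_{\mathfrak a}\in U(n)$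 are defined by $\xi'_{\mathfrak a}=\xi_{\mathfrak a}$ if the restricted sequence of $\mathfrak a$ is $(1,\dots,1)$ (possibly empty), and $\xi'_{\Diamond_i(\mathfrak a)}=(e_i-\mu_{h_i(\mathfrak a)+1})\,\xi'_{\mathfrak a}$ whenever $\mathfrak a$ has a minimum at $i$. **Theorem.** Let $\mathfrak a$ be a half-diagram on $n$ points with restricted sequence $(a_1,\dots,a_m)$, and suppose that $\Delta_k(q)\neq 0$ for all $k$ with $1\le k\le\max_j a_j$. Then $\xi'_{\mathfrak a}$ is well defined (these rules give $\mathfrak a$ exactly one vector, independently of the chosen sequence of box additions), and $$\langle\xi'_{\mathfrak a},\xi'_{\mathfrak a}\rangle=\frac{1}{\mu_{a_1}\cdots\mu_{a_m}}.$$ -/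

import Mathlib

open scoped ComplexConjugate

namespace TemperleyLieb

/-- A noncrossing half-diagram on `n` points. The points `1, …, n` are the elements of `Fin n`
(point `j` is the element with value `j - 1`). `partner j = j` means that `j` carries a
through-string; otherwise `j` is paired with `partner j`. -/
@[ext]
structure HalfDiagram (n : ℕ) where
  partner : Fin n → Fin n
  partner_partner : ∀ i, partner (partner i) = i
  noncrossing : ∀ i k, ¬ (i < k ∧ k < partner i ∧ partner i < partner k)
  noncrossing_through : ∀ i k, ¬ (i < k ∧ k < partner i ∧ partner k = k)

/-- A noncrossing pairing of `2n` points (a basis diagram of `TL_n`): a half-diagram on `2n`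
points without through-strings. -/
structure Pairing (n : ℕ) extends HalfDiagram (2 * n) where
  no_through : ∀ i, partner i ≠ i

/-- The space `U(n)` of formal complex linear combinations of noncrossing half-diagrams. -/
abbrev U (n : ℕ) : Type := HalfDiagram n →₀ ℂ

/-- The basis vector of `U(n)` given by a half-diagram. -/
noncomputable def xi {n : ℕ} (a : HalfDiagram n) : U n := Finsupp.single a 1

/-! ### The sesquilinear form on `U(n)` -/

section Form

variable {n : ℕ}

/-- The edges of the graph obtained from `a` and `b` by identifying equal points. -/
def formEdge (a b : HalfDiagram n) (u v : Fin n) : Prop :=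
  a.partner u = v ∨ b.partner u = v

/-- Being joined by an edge path. -/
def formSetoid (a b : HalfDiagram n) : Setoid (Fin n) :=
  Relation.EqvGen.setoid (formEdge a b)

/-- Some edge path joins two different through-strings of `a`, or two of `b`. -/
def formReturns (a b : HalfDiagram n) : Prop :=
  ∃ u v : Fin n, u ≠ v ∧ formSetoid a b u v ∧
    ((a.partner u = u ∧ a.partner v = v) ∨ (b.partner u = u ∧ b.partner v = v))

/-- The number of closed loops: connected components that meet no through-string. -/
noncomputable def formLoops (a b : HalfDiagram n) : ℕ :=
  Nat.card {c : Quotient (formSetoid a b) //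
    ∀ u : Fin n, Quotient.mk _ u = c → a.partner u ≠ u ∧ b.partner u ≠ u}

open Classical in
/-- The value of the form on two half-diagrams. -/
noncomputable def formBasis (q : ℝ) (a b : HalfDiagram n) : ℝ :=
  if formReturns a b then 0 else q ^ formLoops a b

/-- The form on `U(n)`, linear in the first and conjugate linear in the second variable. -/
noncomputable def form (q : ℝ) (v w : U n) : ℂ :=
  v.sum fun a x => w.sum fun b y => x * conj y * (formBasis q a b : ℂ)

end Form

/-! ### The action of diagrams of `TL_n` on `U(n)` -/

section Action

variable {n : ℕ}

/-- Point `j` (with `1 ≤ j ≤ n`) of a pairing on `2n` points. -/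
def leftPt (j : Fin n) : Fin (2 * n) := ⟨j, by omega⟩

/-- Point `2n - j + 1` (with `1 ≤ j ≤ n`) of a pairing on `2n` points; it is the point that
gets identified with point `j` of a half-diagram. -/
def rightPt (j : Fin n) : Fin (2 * n) := ⟨2 * n - 1 - j, by omega⟩

/-- The edges of the concatenation of the pairing `p` with the half-diagram `a`. -/
def actEdge (p : Pairing n) (a : HalfDiagram n) (u v : Fin (2 * n)) : Prop :=
  p.partner u = v ∨ ∃ j : Fin n, u = rightPt j ∧ v = rightPt (a.partner j)

/-- Being joined by an edge path. -/
def actSetoid (p : Pairing n) (a : HalfDiagram n) : Setoid (Fin (2 * n)) :=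
  Relation.EqvGen.setoid (actEdge p a)

/-- Some edge path joins two different through-strings of `a`. -/
def actReturns (p : Pairing n) (a : HalfDiagram n) : Prop :=
  ∃ j k : Fin n, j ≠ k ∧ a.partner j = j ∧ a.partner k = k ∧
    actSetoid p a (rightPt j) (rightPt k)

/-- The number of closed loops of the concatenation: connected components consisting of
identified points only, none of which has a through-string. -/
noncomputable def actLoops (p : Pairing n) (a : HalfDiagram n) : ℕ :=
  Nat.card {c : Quotient (actSetoid p a) //
    ∀ u : Fin (2 * n), Quotient.mk _ u = c → ∃ j : Fin n, u = rightPt j ∧ a.partner j ≠ j}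

/-- `b` is what is left of the concatenation when closed loops and identified points are
deleted: two points are paired in `b` exactly when an edge path joins them. -/
def IsConcat (p : Pairing n) (a b : HalfDiagram n) : Prop :=
  ∀ j k : Fin n, j ≠ k → (b.partner j = k ↔ actSetoid p a (leftPt j) (leftPt k))

open Classical in
/-- The action of a diagram on a half-diagram. If no through-strings of `a` are joined, then
there is exactly one `b` with `IsConcat p a b`, and the result is `q ^ c • xi b`. -/
noncomputable def actBasis (q : ℝ) (p : Pairing n) (a : HalfDiagram n) : U n :=
  if h : ¬ actReturns p a ∧ ∃ b, IsConcat p a b then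
    ((q : ℂ) ^ actLoops p a) • xi h.2.choose
  else 0

/-- The action of a diagram on `U(n)`. -/
noncomputable def act (q : ℝ) (p : Pairing n) : U n →ₗ[ℂ] U n :=
  Finsupp.linearCombination ℂ (actBasis q p)

/-- The diagram `e_{i+1}` (with `1 ≤ i + 1 ≤ n - 1`): it pairs the points with values `i` and
`i + 1`, the points opposite to them, and every other point with its opposite point. -/
def gen (n i : ℕ) (hi : i + 1 < n) : Pairing n where
  partner j := ⟨if j.1 = i then i + 1 else if j.1 = i + 1 then i
    else if j.1 = 2 * n - 1 - i then 2 * n - 2 - i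
    else if j.1 = 2 * n - 2 - i then 2 * n - 1 - i
    else 2 * n - 1 - j.1, by split_ifs <;> omega⟩
  partner_partner j := by
    ext
    simp only
    split_ifs <;> omega
  noncrossing j k := by
    simp only [Fin.lt_def]
    split_ifs <;> omega
  noncrossing_through j k := by
    simp only [Fin.lt_def, Fin.ext_iff]
    split_ifs <;> omega
  no_through j := by
    simp only [ne_eq, Fin.ext_iff]
    split_ifs <;> omega

end Action

/-! ### Brackets, heights, restricted sequences -/

namespace HalfDiagram

variable {n : ℕ}

/-- The bracket at `j` is a closing bracket; otherwise (paired with a later point, or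
carrying a through-string) it is an opening bracket. -/
def IsClosing (a : HalfDiagram n) (j : Fin n) : Prop := a.partner j < j

open Classical in
/-- The height `h_k`: opening minus closing brackets among the first `k` brackets. (There are
never more closing than opening ones, so the subtraction does not truncate.) -/
noncomputable def height (a : HalfDiagram n) (k : ℕ) : ℕ :=
  (Finset.univ.filter fun j : Fin n => j.1 < k ∧ ¬ a.IsClosing j).card -
    (Finset.univ.filter fun j : Fin n => j.1 < k ∧ a.IsClosing j).card

/-- The points with values `i` and `i + 1` are joined by an (innermost) arch. -/
def HasArch (a : HalfDiagram n) (i : ℕ) : Prop :=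
  ∃ hi : i + 1 < n, a.partner ⟨i, by omega⟩ = ⟨i + 1, hi⟩

/-- The order embedding of `n` points into `n + 2` points that omits the values `i, i + 1`. -/
def skip (i : ℕ) (j : Fin n) : Fin (n + 2) :=
  ⟨if j.1 < i then j.1 else j.1 + 2, by split_ifs <;> omega⟩

theorem partner_skip_ne {a : HalfDiagram (n + 2)} {i : ℕ} (h : a.HasArch i) (j : Fin n) :
    (a.partner (skip i j)).1 ≠ i ∧ (a.partner (skip i j)).1 ≠ i + 1 := by
  obtain ⟨hi, h⟩ := h
  have h' : a.partner ⟨i + 1, hi⟩ = ⟨i, by omega⟩ := by rw [← h, a.partner_partner]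
  have key := a.partner_partner (skip i j)
  constructor
  · intro e
    have e' : a.partner (skip i j) = ⟨i, by omega⟩ := Fin.ext e
    rw [e', h] at key
    have := congrArg Fin.val key
    simp only [skip] at this
    split_ifs at this <;> omega
  · intro e
    have e' : a.partner (skip i j) = ⟨i + 1, hi⟩ := Fin.ext e
    rw [e', h'] at key
    have := congrArg Fin.val key
    simp only [skip] at this
    split_ifs at this <;> omega

/-- The number of the point `k` after the points with values `i` and `i + 1` are removed. -/
def unskip (i k : ℕ) : ℕ := if k < i then k else k - 2

theorem skip_unskip {i : ℕ} (k : Fin (n + 2)) (h1 : k.1 ≠ i)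
    (h2 : k.1 ≠ i + 1) (hk : unskip i k.1 < n) : skip i (⟨unskip i k.1, hk⟩ : Fin n) = k := by
  ext
  simp only [skip, unskip]
  split_ifs <;> omega

theorem skip_lt_skip {i : ℕ} {j k : Fin n} : skip i j < skip i k ↔ j < k := by
  simp only [skip, Fin.lt_def]
  split_ifs <;> omega

theorem skip_injective (i : ℕ) : Function.Injective (skip i : Fin n → Fin (n + 2)) := by
  intro j k h
  have := congrArg Fin.val h
  simp only [skip] at this
  ext
  split_ifs at this <;> omega

/-- The partner function after removal of an arch. -/
def removePartner (a : HalfDiagram (n + 2)) (i : ℕ) (h : a.HasArch i) (j : Fin n) : Fin n :=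
  ⟨unskip i (a.partner (skip i j)).1, by
    have h1 := partner_skip_ne h j
    have h2 := (a.partner (skip i j)).2
    obtain ⟨hi, -⟩ := h
    unfold unskip
    split_ifs <;> omega⟩

theorem skip_removePartner (a : HalfDiagram (n + 2)) (i : ℕ) (h : a.HasArch i) (j : Fin n) :
    skip i (a.removePartner i h j) = a.partner (skip i j) :=
  skip_unskip _ (partner_skip_ne h j).1 (partner_skip_ne h j).2 _

/-- Remove the arch joining the points with values `i` and `i + 1`, and its two points. -/
def removeArch (a : HalfDiagram (n + 2)) (i : ℕ) (h : a.HasArch i) : HalfDiagram n where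
  partner := a.removePartner i h
  partner_partner j := by
    apply skip_injective i
    rw [skip_removePartner, skip_removePartner, a.partner_partner]
  noncrossing j k := by
    have := a.noncrossing (skip i j) (skip i k)
    rw [← skip_removePartner a i h, ← skip_removePartner a i h] at this
    simpa only [skip_lt_skip] using this
  noncrossing_through j k := by
    have := a.noncrossing_through (skip i j) (skip i k)
    rw [← skip_removePartner a i h, ← skip_removePartner a i h] at this
    simpa only [skip_lt_skip, (skip_injective i).eq_iff] using this

open Classical in
/-- The generalized restricted sequence `(a_1, …, a_p)`: if there is an arch, `a_1` is the
smallest number such that the points `a_1` and `a_1 + 1` are joined by an arch, and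
`(a_2, …, a_p)` is the sequence of the diagram with this leftmost innermost arch removed.
The diagram with through-strings only has the empty sequence. -/
noncomputable def restrictedSequence : {n : ℕ} → HalfDiagram n → List ℕ
  | 0, _ => []
  | 1, _ => []
  | _ + 2, a =>
    if h : ∃ i, a.HasArch i then
      (Nat.find h + 1) :: restrictedSequence (a.removeArch (Nat.find h) (Nat.find_spec h))
    else []

/-- The minimal diagrams, whose restricted sequence is `(1, …, 1)`. -/
def IsMinimal (a : HalfDiagram n) : Prop := ∀ x ∈ a.restrictedSequence, x = 1

/-- `b` arises from `a` by box addition at position `i + 1`: `a` has a minimum there (its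
bracket `i + 1` is closing and its bracket `i + 2` is opening), and `b` has the brackets of
`a`, except that bracket `i + 1` is opening and bracket `i + 2` is closing. -/
def IsBoxAddition (i : ℕ) (hi : i + 1 < n) (a b : HalfDiagram n) : Prop :=
  a.IsClosing ⟨i, by omega⟩ ∧ ¬ a.IsClosing ⟨i + 1, hi⟩ ∧
  ¬ b.IsClosing ⟨i, by omega⟩ ∧ b.IsClosing ⟨i + 1, hi⟩ ∧
  ∀ j : Fin n, j.1 ≠ i → j.1 ≠ i + 1 → (b.IsClosing j ↔ a.IsClosing j)

end HalfDiagram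

/-! ### Chebyshev polynomials and the second basis -/

/-- `Δ_k(q)`: the determinant of the `k × k` matrix with diagonal entries `q` and entries `1`
directly above and below the diagonal. -/
noncomputable def Delta (k : ℕ) (q : ℝ) : ℝ :=
  Matrix.det (Matrix.of fun i j : Fin k =>
    if i = j then q else if i.1 + 1 = j.1 ∨ j.1 + 1 = i.1 then 1 else 0)

/-- `μ_k = Δ_{k-1}(q) / Δ_k(q)`, where `Δ_{-1} = 0`. -/
noncomputable def mu (q : ℝ) : ℕ → ℝ
  | 0 => 0
  | k + 1 => Delta k q / Delta (k + 1) q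

/-- `SecondBasis q a v`: the vector `v` is obtained as `ξ'_a` by some sequence of white box
additions, starting from a minimal diagram. -/
inductive SecondBasis (q : ℝ) {n : ℕ} : HalfDiagram n → U n → Prop
  | minimal (a : HalfDiagram n) (ha : a.IsMinimal) : SecondBasis q a (xi a)
  | box (i : ℕ) (hi : i + 1 < n) (a b : HalfDiagram n) (v : U n)
      (hab : HalfDiagram.IsBoxAddition i hi a b) (hv : SecondBasis q a v) :
      SecondBasis q b
        (act q (gen n i hi) v - ((mu q (a.height (i + 1) + 1) : ℝ) : ℂ) • v)

/-- The vector `ξ'_a` of the second basis. -/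
noncomputable def xiPrime (q : ℝ) {n : ℕ} (a : HalfDiagram n) : U n :=
  Classical.epsilon (SecondBasis q a)

end TemperleyLieb

/-!
The generator `e_i` joins the points `i` and `i + 1` of a half-diagram, is self-adjoint for the
form, and satisfies the Temperley–Lieb relations. A half-diagram is determined by its bracket word,
adding a box interchanges two brackets, and joining the points of a minimum adds a box. Everything
is proved by induction on the number of boxes.

Two boxes that can be removed from the same word are far apart, so their generators commute and
`ξ'` does not depend on the order of the boxes. Write `v` for the vector before a box is added at
height `k`, and `μ = μ_k`. By `μ_{k+1} (q - μ_k) = 1`, the generator `e_i` annihilates `ξ'` when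
the brackets `i` and `i + 1` are equal. Consequently `e_1 ⋯ e_i` maps `v`, which has a minimum at
`i`, to the vector of the half-diagram in which this minimum is removed and an arch is put in front;
as `‖e_1 ⋯ e_i v‖² = q ⟨e_i v, v⟩`, this yields `⟨e_i v, v⟩ = P`, the product of the `1 / μ_x` over
the other entries `x` of the restricted sequence. Hence
`‖(e_i - μ) v‖² = (q - 2 μ) P + μ² (P / μ) = (q - μ) P = P / μ_{k+1}`.
-/

namespace TemperleyLieb

section Involutions

variable {α : Type*} [DecidableEq α] {p : α → α} {s t u v : α}

/-- The involution obtained from `p` by concatenation with a cup and a cap at `s` and `t`: it joins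
`s` with `t`, and the former partners of `s` and `t` with each other. -/
def joinFun (p : α → α) (s t x : α) : α :=
  if x = s then t else if x = t then s
  else if p x = s then (if p t = t then x else p t)
  else if p x = t then (if p s = s then x else p s)
  else p x

theorem joinFun_involutive (hp : Function.Involutive p) : Function.Involutive (joinFun p s t) := by
  intro x
  have := hp x
  have := hp s
  have := hp t
  unfold joinFun
  grind

theorem joinFun_symm (hp : Function.Involutive p) : joinFun p s t = joinFun p t s := by
  ext x
  have := hp x
  unfold joinFun
  grind

theorem joinFun_eq_self (hp : Function.Involutive p) (h : p s = t) : joinFun p s t = p := by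
  ext x
  have := hp x
  have := hp s
  unfold joinFun
  grind

theorem joinFun_braid (hp : Function.Involutive p) (hst : s ≠ t) (hsu : s ≠ u) (htu : t ≠ u)
    (h : p s = t) : joinFun (joinFun p t u) s t = p := by
  ext x
  have := hp x
  have := hp s
  have := hp u
  unfold joinFun at *
  grind

variable {R : Type*} [CommMonoidWithZero R] (q : R)

/-- The scalar produced by joining `s` and `t`: `q` if they are partners already, as this closes a
loop, `0` if both are fixed, as this joins two through-strings, and `1` otherwise. -/
def joinWeight (p : α → α) (s t : α) : R :=
  if p s = t then q else if p s = s ∧ p t = t then 0 else 1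

theorem joinWeight_symm (hp : Function.Involutive p) :
    joinWeight q p s t = joinWeight q p t s := by
  have := hp s
  have := hp t
  unfold joinWeight
  grind

theorem joinWeight_braid (hp : Function.Involutive p) (hst : s ≠ t) (hsu : s ≠ u) (htu : t ≠ u)
    (h : p s = t) : joinWeight q p t u * joinWeight q (joinFun p t u) s t = 1 := by
  have := hp s
  have := hp u
  unfold joinWeight joinFun
  grind [one_mul]

theorem not_fixed_of_joinWeight_ne_zero (hst : s ≠ t) (h : joinWeight q p s t ≠ 0) :
    ¬ (p s = s ∧ p t = t) := by
  unfold joinWeight at h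
  grind

theorem joinWeight_comm (hp : Function.Involutive p) (hsu : s ≠ u) (hsv : s ≠ v) (htu : t ≠ u)
    (htv : t ≠ v) (hst : s ≠ t) (huv : u ≠ v) :
    joinWeight q p s t * joinWeight q (joinFun p s t) u v =
      joinWeight q p u v * joinWeight q (joinFun p u v) s t := by
  have := hp s
  have := hp t
  have := hp u
  have := hp v
  simp only [joinWeight, joinFun, if_neg hsu.symm, if_neg htu.symm, if_neg hsv.symm,
    if_neg htv.symm, if_neg hsu, if_neg hsv, if_neg htu, if_neg htv]
  grind (splits := 40) [mul_zero, zero_mul, mul_one, one_mul]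

theorem joinFun_comm (hp : Function.Involutive p) (hsu : s ≠ u) (hsv : s ≠ v) (htu : t ≠ u)
    (htv : t ≠ v) (hst : s ≠ t) (huv : u ≠ v)
    (h : joinWeight q p s t * joinWeight q (joinFun p s t) u v ≠ 0) :
    joinFun (joinFun p s t) u v = joinFun (joinFun p u v) s t := by
  have := not_fixed_of_joinWeight_ne_zero q hst (left_ne_zero_of_mul h)
  have := not_fixed_of_joinWeight_ne_zero q huv (right_ne_zero_of_mul h)
  ext x
  have := hp x
  have := hp s
  have := hp t
  have := hp u
  have := hp v
  unfold joinFun at *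
  grind (splits := 40)

end Involutions

section Noncrossing

variable {α : Type*} [LinearOrder α] {p : α → α} {s t : α}

/-- A map is noncrossing if everything strictly below an arch `j < p j` stays strictly below it and
is not fixed. For an involution this says that arches neither cross each other nor cover fixed
points. -/
def Noncrossing (p : α → α) : Prop :=
  ∀ ⦃j k⦄, j < k → k < p j → j < p k ∧ p k < p j ∧ p k ≠ k

protected theorem Noncrossing.joinFun (h : Noncrossing p) (hp : Function.Involutive p)
    (hst : s ⋖ t) : Noncrossing (joinFun p s t) := by
  -- No point lies between `s` and `t`, so an arch crossing `{p s, p t}` already crosses `{s, p s}`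
  -- or `{t, p t}`; the instances of `h` collected below are the ones this argument uses.
  intro j k hjk hkj
  have adj (x : α) : x ≤ s ∨ t ≤ x := (le_or_gt x s).imp_right hst.ge_of_gt
  have hlt := hst.lt
  have hs := hp s
  have ht := hp t
  have hj := hp j
  have hk := hp k
  have adj_k := adj k
  have adj_j := adj j
  have in_jk := @h j k hjk
  have in_js := @h j s
  have in_jt := @h j t
  have hjs : j ≠ s := by grind [joinFun]
  have hjt : j ≠ t := by grind [joinFun]
  by_cases hpjs : p j = s
  · have in_st := @h s t
    have in_tk := @h t k
    have in_jpt := @h j (p t)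
    have adj_pt := adj (p t)
    clear h hp hst adj
    grind (splits := 20) +splitImp [joinFun]
  by_cases hpjt : p j = t
  · have in_jps := @h j (p s)
    have in_sk := @h s k
    have in_pspk := @h (p s) (p k)
    have in_tpk := @h t (p k)
    have adj_ps := adj (p s)
    have adj_pk := adj (p k)
    clear h hp hst adj
    grind (splits := 20) +splitImp [joinFun]
  have adj_pj := adj (p j)
  clear h hp hst adj
  grind (splits := 20) +splitImp [joinFun]

end Noncrossing

namespace HalfDiagram

variable {n : ℕ} (a : HalfDiagram n) {i j : ℕ}

theorem partner_involutive : Function.Involutive a.partner := a.partner_partner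

theorem partner_noncrossing : Noncrossing a.partner := by
  intro u v huv hv
  have partner_v_ne : a.partner v ≠ u := fun h => by
    rw [← h, a.partner_partner] at hv
    exact hv.false
  have partner_v_ne' : a.partner v ≠ a.partner u := a.partner_involutive.injective.ne huv.ne'
  refine ⟨?_, ?_, fun h => a.noncrossing_through u v ⟨huv, hv, h⟩⟩
  · by_contra h
    refine a.noncrossing (a.partner v) u ⟨(not_lt.1 h).lt_of_ne partner_v_ne, ?_⟩
    rw [a.partner_partner]
    exact ⟨huv, hv⟩
  · by_contra h
    exact a.noncrossing u v ⟨huv, hv, (not_lt.1 h).lt_of_ne' partner_v_ne'⟩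

theorem hasArch_iff (hi : i + 1 < n) : a.HasArch i ↔ a.partner ⟨i, by omega⟩ = ⟨i + 1, hi⟩ :=
  ⟨fun h => h.2, fun h => ⟨hi, h⟩⟩

/-- The half-diagram of the concatenation of `e_{i+1}` with `a`. -/
def join (i : ℕ) (hi : i + 1 < n) : HalfDiagram n where
  partner := joinFun a.partner ⟨i, by omega⟩ ⟨i + 1, hi⟩
  partner_partner := joinFun_involutive a.partner_involutive
  noncrossing j k := fun ⟨hjk, hk, hk'⟩ =>
    ((a.partner_noncrossing.joinFun a.partner_involutive (by simp [Fin.covBy_iff]))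
      hjk hk).2.1.not_gt hk'
  noncrossing_through j k := fun ⟨hjk, hk, hk'⟩ =>
    ((a.partner_noncrossing.joinFun a.partner_involutive (by simp [Fin.covBy_iff]))
      hjk hk).2.2 hk'

/-- The scalar produced by the concatenation of `e_{i+1}` with `a`. -/
def weight {R : Type*} [CommMonoidWithZero R] (q : R) (i : ℕ) (hi : i + 1 < n) : R :=
  joinWeight q a.partner ⟨i, by omega⟩ ⟨i + 1, hi⟩

theorem hasArch_join (hi : i + 1 < n) : (a.join i hi).HasArch i :=
  ⟨hi, by simp [join, joinFun]⟩

variable {R : Type*} [CommMonoidWithZero R] (q : R)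

theorem weight_mul_weight_join_comm (hi : i + 1 < n) (hj : j + 1 < n) (hij : i + 2 ≤ j) :
    a.weight q i hi * (a.join i hi).weight q j hj =
      a.weight q j hj * (a.join j hj).weight q i hi :=
  joinWeight_comm q a.partner_involutive (by simp; omega) (by simp; omega) (by simp; omega)
    (by simp; omega) (by simp) (by simp)

theorem join_join_comm (hi : i + 1 < n) (hj : j + 1 < n) (hij : i + 2 ≤ j)
    (h : a.weight q i hi * (a.join i hi).weight q j hj ≠ 0) :
    (a.join i hi).join j hj = (a.join j hj).join i hi := by
  ext1
  exact joinFun_comm q a.partner_involutive (by simp; omega) (by simp; omega) (by simp; omega)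
    (by simp; omega) (by simp) (by simp) h

variable {a}

theorem HasArch.partner_right (h : a.HasArch i) (hi : i + 1 < n) :
    a.partner ⟨i + 1, hi⟩ = ⟨i, by omega⟩ := by
  rw [← (a.hasArch_iff hi).1 h, a.partner_partner]

theorem HasArch.join_eq_self (h : a.HasArch i) (hi : i + 1 < n) : a.join i hi = a := by
  ext1
  exact joinFun_eq_self a.partner_involutive ((a.hasArch_iff hi).1 h)

theorem HasArch.weight_eq (h : a.HasArch i) (hi : i + 1 < n) : a.weight q i hi = q :=
  if_pos ((a.hasArch_iff hi).1 h)

theorem HasArch.join_succ_join (h : a.HasArch i) (hi : i + 2 < n) :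
    (a.join (i + 1) hi).join i (by omega) = a := by
  ext1
  exact joinFun_braid a.partner_involutive (by simp) (by simp; omega) (by simp)
    ((a.hasArch_iff (by omega)).1 h)

theorem HasArch.join_join_succ (h : a.HasArch (i + 1)) (hi : i + 2 < n) :
    (a.join i (by omega)).join (i + 1) hi = a := by
  ext1
  simp only [join]
  rw [joinFun_symm (joinFun_involutive a.partner_involutive), joinFun_symm a.partner_involutive]
  exact joinFun_braid a.partner_involutive (by simp) (by simp; omega) (by simp) (h.partner_right hi)

theorem HasArch.weight_succ_mul_weight (h : a.HasArch i) (hi : i + 2 < n) :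
    a.weight q (i + 1) hi * (a.join (i + 1) hi).weight q i (by omega) = 1 :=
  joinWeight_braid q a.partner_involutive (by simp) (by simp; omega) (by simp)
    ((a.hasArch_iff (by omega)).1 h)

theorem HasArch.weight_mul_weight_succ (h : a.HasArch (i + 1)) (hi : i + 2 < n) :
    a.weight q i (by omega) * (a.join i (by omega)).weight q (i + 1) hi = 1 := by
  simp only [weight, join]
  rw [joinWeight_symm q (joinFun_involutive a.partner_involutive),
    joinFun_symm a.partner_involutive, joinWeight_symm q a.partner_involutive]
  exact joinWeight_braid q a.partner_involutive (by simp) (by simp; omega) (by simp)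
    (h.partner_right hi)

end HalfDiagram

section ActionOfGenerators

variable {n : ℕ}

theorem exists_eq_leftPt_or_eq_rightPt (u : Fin (2 * n)) :
    ∃ j : Fin n, u = leftPt j ∨ u = rightPt j := by
  by_cases h : u.1 < n
  · exact ⟨⟨u.1, h⟩, Or.inl rfl⟩
  · refine ⟨⟨2 * n - 1 - u.1, by omega⟩, Or.inr ?_⟩
    ext
    simp only [rightPt]
    omega

theorem rightPt_injective : Function.Injective (rightPt : Fin n → Fin (2 * n)) := by
  intro j k h
  have := congrArg Fin.val h
  simp only [rightPt] at this
  ext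
  omega

theorem leftPt_ne_rightPt (j k : Fin n) : leftPt j ≠ rightPt k := by
  intro h
  have := congrArg Fin.val h
  simp only [rightPt, leftPt] at this
  omega

/-- The connected component `c` of the concatenation is a closed loop. -/
def IsActLoop (p : Pairing n) (a : HalfDiagram n) (c : Quotient (actSetoid p a)) : Prop :=
  ∀ u : Fin (2 * n), Quotient.mk _ u = c → ∃ j : Fin n, u = rightPt j ∧ a.partner j ≠ j

/-- A point among `1, …, n` connected to the cap of `e_{i+1}` in its concatenation with `a`, or
`none` if the cap lies on a closed loop. -/
def capLabel (a : HalfDiagram n) (i : ℕ) (hi : i + 1 < n) : Option (Fin n) :=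
  if a.partner ⟨i, by omega⟩ = ⟨i + 1, hi⟩ then none
  else if a.partner ⟨i, by omega⟩ = ⟨i, by omega⟩ then some (a.partner ⟨i + 1, hi⟩)
  else some (a.partner ⟨i, by omega⟩)

/-- A point among `1, …, n` connected to `u` in the concatenation of `e_{i+1}` with `a`, or `none`
if `u` lies on a closed loop. -/
def actLabel (a : HalfDiagram n) (i : ℕ) (hi : i + 1 < n) (u : Fin (2 * n)) : Option (Fin n) :=
  if h : u.1 < n then some ⟨u.1, h⟩
  else if 2 * n - 1 - u.1 = i ∨ 2 * n - 1 - u.1 = i + 1 then capLabel a i hi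
  else some ⟨2 * n - 1 - u.1, by omega⟩

/-- Two labels are equivalent if they are equal or partners in the half-diagram. -/
def labelSetoid (b : HalfDiagram n) : Setoid (Option (Fin n)) where
  r o o' := o = o' ∨ o' = o.map b.partner
  iseqv.refl _ := Or.inl rfl
  iseqv.symm := by
    rintro o _ (rfl | rfl)
    · exact Or.inl rfl
    · simp [Function.comp_def, b.partner_partner]
  iseqv.trans := by
    rintro o _ _ (rfl | rfl) (rfl | rfl)
    · exact Or.inl rfl
    · exact Or.inr rfl
    · exact Or.inr rfl
    · simp [Function.comp_def, b.partner_partner]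

variable {p : Pairing n} {a : HalfDiagram n} {i : ℕ} {hi : i + 1 < n} {j : Fin n}

theorem gen_partner_leftPt : (gen n i hi).partner (leftPt j) =
    if j = ⟨i, by omega⟩ then leftPt ⟨i + 1, hi⟩ else
      if j = ⟨i + 1, hi⟩ then leftPt ⟨i, by omega⟩ else rightPt j := by
  ext
  simp only [gen, leftPt, rightPt, Fin.ext_iff]
  split_ifs <;> simp only <;> omega

theorem gen_partner_rightPt : (gen n i hi).partner (rightPt j) =
    if j = ⟨i, by omega⟩ then rightPt ⟨i + 1, hi⟩ else
      if j = ⟨i + 1, hi⟩ then rightPt ⟨i, by omega⟩ else leftPt j := by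
  ext
  simp only [gen, leftPt, rightPt, Fin.ext_iff]
  split_ifs <;> simp only <;> omega

theorem IsConcat.unique {b b' : HalfDiagram n} (h : IsConcat p a b) (h' : IsConcat p a b') :
    b = b' := by
  ext j : 2
  by_cases hj : b.partner j = j
  · by_contra hne
    have hj' : b'.partner j ≠ j := fun hj' => hne (hj.trans hj'.symm)
    exact hne ((h _ _ hj'.symm).2 ((h' _ _ hj'.symm).1 rfl))
  · exact ((h' _ _ (Ne.symm hj)).2 ((h _ _ (Ne.symm hj)).1 rfl)).symm

theorem actSetoid_partner (u : Fin (2 * n)) : actSetoid p a u (p.partner u) :=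
  Relation.EqvGen.rel _ _ (Or.inl rfl)

theorem actSetoid_rightPt_partner (j : Fin n) :
    actSetoid p a (rightPt j) (rightPt (a.partner j)) :=
  Relation.EqvGen.rel _ _ (Or.inr ⟨j, rfl, rfl⟩)

theorem actSetoid_gen_leftPt_rightPt (hj : j ≠ ⟨i, by omega⟩) (hj' : j ≠ ⟨i + 1, hi⟩) :
    actSetoid (gen n i hi) a (leftPt j) (rightPt j) := by
  simpa only [gen_partner_leftPt, if_neg hj, if_neg hj'] using
    actSetoid_partner (p := gen n i hi) (a := a) (leftPt j)

theorem actSetoid_gen_leftPt_leftPt :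
    actSetoid (gen n i hi) a (leftPt ⟨i, by omega⟩) (leftPt ⟨i + 1, hi⟩) := by
  simpa only [gen_partner_leftPt, if_true] using
    actSetoid_partner (p := gen n i hi) (a := a) (leftPt ⟨i, by omega⟩)

theorem actSetoid_gen_rightPt_rightPt :
    actSetoid (gen n i hi) a (rightPt ⟨i, by omega⟩) (rightPt ⟨i + 1, hi⟩) := by
  simpa only [gen_partner_rightPt, if_true] using
    actSetoid_partner (p := gen n i hi) (a := a) (rightPt ⟨i, by omega⟩)

theorem actLabel_leftPt : actLabel a i hi (leftPt j) = some j := by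
  simp [actLabel, leftPt]

theorem actLabel_rightPt : actLabel a i hi (rightPt j) =
    if j = ⟨i, by omega⟩ ∨ j = ⟨i + 1, hi⟩ then capLabel a i hi else some j := by
  have not_left : ¬ 2 * n - 1 - j.1 < n := by omega
  have opposite : 2 * n - 1 - (2 * n - 1 - j.1) = j.1 := by omega
  simp only [actLabel, rightPt, dif_neg not_left, opposite, Fin.ext_iff]

theorem labelSetoid_apply {b : HalfDiagram n} {o o' : Option (Fin n)} :
    labelSetoid b o o' ↔ o = o' ∨ o' = o.map b.partner := Iff.rfl

theorem labelSetoid_join_gen_partner (u : Fin (2 * n)) :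
    labelSetoid (a.join i hi) (actLabel a i hi u) (actLabel a i hi ((gen n i hi).partner u)) := by
  obtain ⟨j, rfl | rfl⟩ := exists_eq_leftPt_or_eq_rightPt u
  · rw [gen_partner_leftPt]
    have := a.hasArch_join hi
    split_ifs with hj hj'
    · simp [hj, actLabel_leftPt, labelSetoid_apply, this.2]
    · simp [hj', actLabel_leftPt, labelSetoid_apply, this.partner_right hi]
    · simp [hj, hj', actLabel_leftPt, actLabel_rightPt]
  · rw [gen_partner_rightPt]
    split_ifs with hj hj'
    · simp [hj, actLabel_rightPt]
    · simp [hj', actLabel_rightPt]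
    · simp [hj, hj', actLabel_leftPt, actLabel_rightPt]

theorem labelSetoid_join_rightPt_partner (j : Fin n) :
    labelSetoid (a.join i hi) (actLabel a i hi (rightPt j))
      (actLabel a i hi (rightPt (a.partner j))) := by
  have := a.partner_partner j
  have := a.partner_partner ⟨i, by omega⟩
  have := a.partner_partner ⟨i + 1, hi⟩
  simp only [actLabel_rightPt, labelSetoid_apply, capLabel, HalfDiagram.join]
  grind [joinFun]

theorem actSetoid_gen_le :
    actSetoid (gen n i hi) a ≤ (labelSetoid (a.join i hi)).comap (actLabel a i hi) := by
  refine Setoid.eqvGen_le (s := (labelSetoid _).comap _) ?_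
  rintro u _ (rfl | ⟨j, rfl, rfl⟩)
  · exact labelSetoid_join_gen_partner u
  · exact labelSetoid_join_rightPt_partner j

theorem actSetoid_gen_join_partner (j : Fin n) :
    actSetoid (gen n i hi) a (leftPt j) (leftPt ((a.join i hi).partner j)) := by
  have left_right := @actSetoid_gen_leftPt_rightPt n a i hi
  have cup := @actSetoid_gen_leftPt_leftPt n a i hi
  have cap := @actSetoid_gen_rightPt_rightPt n a i hi
  have arch := actSetoid_rightPt_partner (p := gen n i hi) (a := a)
  have := a.partner_partner j
  have := a.partner_partner ⟨i, by omega⟩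
  have := a.partner_partner ⟨i + 1, hi⟩
  generalize actSetoid (gen n i hi) a = R at *
  simp only [HalfDiagram.join, joinFun]
  split_ifs with hj hj' hpj hs hpj' ht
  · exact hj ▸ cup
  · exact hj' ▸ R.symm cup
  · exact R.refl _
  · have hjs := R.trans (left_right hj hj') (arch j)
    rw [hpj] at hjs
    exact R.trans hjs (R.trans cap (R.trans (arch _) (R.symm (left_right (by grind) hs))))
  · exact R.refl _
  · have hjt := R.trans (left_right hj hj') (arch j)
    rw [hpj'] at hjt
    exact R.trans hjt (R.trans (R.symm cap) (R.trans (arch _) (R.symm (left_right ht (by grind)))))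
  · exact R.trans (R.trans (left_right hj hj') (arch j)) (R.symm (left_right hpj hpj'))

theorem isConcat_gen_join : IsConcat (gen n i hi) a (a.join i hi) := by
  intro j k hjk
  constructor
  · rintro rfl
    exact actSetoid_gen_join_partner j
  · intro h
    simpa [Setoid.comap_rel, actLabel_leftPt, labelSetoid_apply, hjk, eq_comm] using
      actSetoid_gen_le h

theorem actReturns_gen_iff : actReturns (gen n i hi) a ↔
    a.partner ⟨i, by omega⟩ = ⟨i, by omega⟩ ∧ a.partner ⟨i + 1, hi⟩ = ⟨i + 1, hi⟩ := by
  constructor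
  · rintro ⟨j, k, hjk, hj, hk, h⟩
    have labels := actSetoid_gen_le h
    have := a.partner_partner ⟨i, by omega⟩
    have := a.partner_partner ⟨i + 1, hi⟩
    simp only [Setoid.comap_rel, actLabel_rightPt, labelSetoid_apply, capLabel,
      HalfDiagram.join] at labels
    grind [joinFun]
  · rintro ⟨hs, ht⟩
    exact ⟨_, _, by simp, hs, ht, actSetoid_gen_rightPt_rightPt⟩

theorem actLoops_eq_card (p : Pairing n) (a : HalfDiagram n) :
    actLoops p a = Nat.card {c // IsActLoop p a c} := rfl

theorem IsActLoop.exists_eq_rightPt {u : Fin (2 * n)}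
    (h : IsActLoop (gen n i hi) a (Quotient.mk _ u)) :
    u = rightPt ⟨i, by omega⟩ ∨ u = rightPt ⟨i + 1, hi⟩ := by
  obtain ⟨j, rfl, -⟩ := h u rfl
  by_contra! hne
  have left_right := actSetoid_gen_leftPt_rightPt (a := a) (hi := hi) (ne_of_apply_ne _ hne.1)
    (ne_of_apply_ne _ hne.2)
  obtain ⟨k, hk, -⟩ := h (leftPt j) (Quotient.sound left_right)
  exact leftPt_ne_rightPt _ _ hk

theorem IsActLoop.eq_mk_rightPt {c : Quotient (actSetoid (gen n i hi) a)}
    (h : IsActLoop (gen n i hi) a c) : c = Quotient.mk _ (rightPt ⟨i, by omega⟩) := by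
  induction c using Quotient.inductionOn with | _ u => ?_
  obtain rfl | rfl := h.exists_eq_rightPt
  · rfl
  · exact Quotient.sound (Setoid.symm' _ actSetoid_gen_rightPt_rightPt)

theorem isActLoop_mk_rightPt_iff :
    IsActLoop (gen n i hi) a (Quotient.mk _ (rightPt ⟨i, by omega⟩)) ↔ a.HasArch i := by
  rw [a.hasArch_iff hi]
  constructor
  · intro h
    obtain ⟨k, hk, hne⟩ := h _ rfl
    rw [← rightPt_injective hk] at hne
    have same : (⟦rightPt (a.partner ⟨i, by omega⟩)⟧ : Quotient (actSetoid (gen n i hi) a)) =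
      ⟦rightPt ⟨i, by omega⟩⟧ := Quotient.sound (Setoid.symm' _ (actSetoid_rightPt_partner _))
    rw [← same] at h
    exact rightPt_injective (h.exists_eq_rightPt.resolve_left (rightPt_injective.ne hne))
  · intro h u hu
    have labels := actSetoid_gen_le (Quotient.exact hu)
    obtain ⟨j, rfl | rfl⟩ := exists_eq_leftPt_or_eq_rightPt u
    · simp [Setoid.comap_rel, actLabel_leftPt, actLabel_rightPt, labelSetoid_apply, capLabel,
        h] at labels
    · refine ⟨j, rfl, ?_⟩
      have := a.partner_partner ⟨i, by omega⟩
      simp only [Setoid.comap_rel, actLabel_rightPt, labelSetoid_apply, capLabel, h] at labels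
      grind

theorem HalfDiagram.HasArch.actLoops_gen (h : a.HasArch i) : actLoops (gen n i hi) a = 1 := by
  rw [actLoops_eq_card, Nat.card_eq_one_iff_unique]
  exact ⟨⟨fun c d => Subtype.ext (c.2.eq_mk_rightPt.trans d.2.eq_mk_rightPt.symm)⟩,
    ⟨⟨_, isActLoop_mk_rightPt_iff.2 h⟩⟩⟩

theorem actLoops_gen_of_not_hasArch (h : ¬ a.HasArch i) : actLoops (gen n i hi) a = 0 := by
  rw [actLoops_eq_card, Nat.card_eq_zero]
  refine Or.inl ⟨fun c => h ((isActLoop_mk_rightPt_iff (hi := hi)).1 ?_)⟩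
  exact c.2.eq_mk_rightPt ▸ c.2

theorem actBasis_gen (q : ℝ) (a : HalfDiagram n) :
    actBasis q (gen n i hi) a = ((a.weight q i hi : ℝ) : ℂ) • xi (a.join i hi) := by
  rw [actBasis, HalfDiagram.weight, joinWeight]
  split_ifs with h harch hfixed harch hfixed
  · rw [h.2.choose_spec.unique isConcat_gen_join, HalfDiagram.HasArch.actLoops_gen ⟨hi, harch⟩,
      pow_one]
  · exact absurd (actReturns_gen_iff.2 hfixed) h.1
  · rw [h.2.choose_spec.unique isConcat_gen_join,
      actLoops_gen_of_not_hasArch (mt (a.hasArch_iff hi).1 harch), pow_zero, Complex.ofReal_one]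
  · refine absurd ⟨fun hret => ?_, _, isConcat_gen_join⟩ h
    have := (actReturns_gen_iff.1 hret).1
    simp_all
  · simp
  · exact absurd ⟨fun hret => hfixed (actReturns_gen_iff.1 hret), _, isConcat_gen_join⟩ h

end ActionOfGenerators

section Generators

variable {n : ℕ} {i j : ℕ} (q : ℝ) (n i)

/-- The action of `e_{i+1}` on `U(n)`, and `0` if there is no such diagram. -/
noncomputable def genOp : U n →ₗ[ℂ] U n :=
  if hi : i + 1 < n then act q (gen n i hi) else 0

variable {n i}

theorem genOp_of_lt (hi : i + 1 < n) : genOp q n i = act q (gen n i hi) := dif_pos hi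

theorem genOp_of_not_lt (hi : ¬ i + 1 < n) : genOp q n i = 0 := dif_neg hi

theorem genOp_xi (hi : i + 1 < n) (a : HalfDiagram n) :
    genOp q n i (xi a) = ((a.weight q i hi : ℝ) : ℂ) • xi (a.join i hi) := by
  rw [genOp_of_lt q hi, act, xi, Finsupp.linearCombination_single, one_smul, actBasis_gen]

theorem hom_ext_xi {V : Type*} [AddCommMonoid V] [Module ℂ V] {f g : U n →ₗ[ℂ] V}
    (h : ∀ a, f (xi a) = g (xi a)) : f = g :=
  Finsupp.lhom_ext' fun a => LinearMap.ext_ring (h a)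

protected theorem HalfDiagram.HasArch.genOp_xi {a : HalfDiagram n} (h : a.HasArch i) :
    genOp q n i (xi a) = (q : ℂ) • xi a := by
  obtain ⟨hi, -⟩ := id h
  rw [genOp_xi q hi, h.weight_eq, h.join_eq_self]

theorem HalfDiagram.HasArch.genOp_genOp_succ_xi {a : HalfDiagram n} (h : a.HasArch i)
    (hi : i + 2 < n) : genOp q n i (genOp q n (i + 1) (xi a)) = xi a := by
  rw [genOp_xi q hi, map_smul, genOp_xi q (by omega), smul_smul,
    h.join_succ_join hi, ← Complex.ofReal_mul, h.weight_succ_mul_weight, Complex.ofReal_one,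
    one_smul]

theorem HalfDiagram.HasArch.genOp_succ_genOp_xi {a : HalfDiagram n} (h : a.HasArch (i + 1)) :
    genOp q n (i + 1) (genOp q n i (xi a)) = xi a := by
  obtain ⟨hi, -⟩ := id h
  rw [genOp_xi q (by omega), map_smul, genOp_xi q hi, smul_smul,
    h.join_join_succ hi, ← Complex.ofReal_mul, h.weight_mul_weight_succ, Complex.ofReal_one,
    one_smul]

theorem genOp_mul_self : genOp q n i * genOp q n i = (q : ℂ) • genOp q n i := by
  by_cases hi : i + 1 < n
  · refine hom_ext_xi fun a => ?_
    rw [Module.End.mul_apply, LinearMap.smul_apply, genOp_xi q hi, map_smul,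
      (a.hasArch_join hi).genOp_xi, smul_comm]
  · simp [genOp_of_not_lt q hi]

theorem genOp_mul_genOp_succ_mul_genOp (hi : i + 2 < n) :
    genOp q n i * genOp q n (i + 1) * genOp q n i = genOp q n i := by
  refine hom_ext_xi fun a => ?_
  rw [Module.End.mul_apply, Module.End.mul_apply, genOp_xi q (by omega), map_smul, map_smul,
    (a.hasArch_join _).genOp_genOp_succ_xi q hi]

theorem genOp_succ_mul_genOp_mul_genOp_succ :
    genOp q n (i + 1) * genOp q n i * genOp q n (i + 1) = genOp q n (i + 1) := by
  by_cases hi : i + 1 + 1 < n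
  · refine hom_ext_xi fun a => ?_
    rw [Module.End.mul_apply, Module.End.mul_apply, genOp_xi q hi, map_smul, map_smul,
      (a.hasArch_join _).genOp_succ_genOp_xi]
  · simp [genOp_of_not_lt q hi]

theorem commute_genOp (hij : i + 2 ≤ j) : Commute (genOp q n i) (genOp q n j) := by
  by_cases hj : j + 1 < n
  · have hi : i + 1 < n := by omega
    refine hom_ext_xi fun a => ?_
    simp only [Module.End.mul_apply, genOp_xi q hi, genOp_xi q hj, map_smul, smul_smul,
      ← Complex.ofReal_mul, ← a.weight_mul_weight_join_comm q hi hj hij]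
    by_cases h : a.weight q i hi * (a.join i hi).weight q j hj = 0
    · simp [h]
    · rw [a.join_join_comm q hi hj hij h]
  · simp [genOp_of_not_lt q hj]

end Generators

section FormOfJoin

variable {n : ℕ}

/-- A retraction onto the points other than those with values `i` and `i + 1`: it moves these two
to the former partner of one of them in `b`. -/
def joinRep (b : HalfDiagram n) (i : ℕ) (hi : i + 1 < n) (u : Fin n) : Fin n :=
  if u = ⟨i, by omega⟩ ∨ u = ⟨i + 1, hi⟩ then
    if b.partner ⟨i, by omega⟩ = ⟨i, by omega⟩ then b.partner ⟨i + 1, hi⟩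
    else b.partner ⟨i, by omega⟩
  else u

variable {a b c : HalfDiagram n} {i : ℕ} {hi : i + 1 < n} {u v : Fin n}

theorem formBasis_symm (q : ℝ) (a b : HalfDiagram n) : formBasis q a b = formBasis q b a := by
  have edge : formEdge a b = formEdge b a := by
    ext u v
    exact or_comm
  have returns : formReturns a b ↔ formReturns b a := by
    unfold formReturns formSetoid
    rw [edge]
    simp only [or_comm]
  have loops : formLoops a b = formLoops b a := by
    unfold formLoops formSetoid
    rw [edge]
    simp only [and_comm]
  rw [formBasis, formBasis, propext returns, loops]

theorem formSetoid_partner_left (u : Fin n) : formSetoid a b u (a.partner u) :=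
  Relation.EqvGen.rel _ _ (Or.inl rfl)

theorem formSetoid_partner_right (u : Fin n) : formSetoid a b u (b.partner u) :=
  Relation.EqvGen.rel _ _ (Or.inr rfl)

theorem formSetoid_le {S : Setoid (Fin n)} (left : ∀ u, S u (a.partner u))
    (right : ∀ u, S u (b.partner u)) : formSetoid a b ≤ S := by
  refine Setoid.eqvGen_le ?_
  rintro u _ (rfl | rfl)
  · exact left u
  · exact right u

theorem HalfDiagram.HasArch.formSetoid (hc : c.HasArch i) :
    formSetoid c b ⟨i, by omega⟩ ⟨i + 1, hi⟩ := by
  simpa only [(c.hasArch_iff hi).1 hc] using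
    formSetoid_partner_left (a := c) (b := b) ⟨i, by omega⟩

theorem formSetoid_join_le (hc : c.HasArch i) : formSetoid c (b.join i hi) ≤ formSetoid c b := by
  refine formSetoid_le formSetoid_partner_left fun u => ?_
  have hst := hc.formSetoid (b := b) (hi := hi)
  have hb := formSetoid_partner_right (a := c) (b := b)
  simp only [HalfDiagram.join, joinFun]
  generalize formSetoid c b = R at *
  split_ifs with hs ht hus _ hut _
  · exact hs ▸ hst
  · exact ht ▸ R.symm hst
  · exact R.refl _
  · exact R.trans (hus ▸ hb u) (R.trans hst (hb _))
  · exact R.refl _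
  · exact R.trans (hut ▸ hb u) (R.trans (R.symm hst) (hb _))
  · exact hb u

theorem formSetoid_joinRep (hc : c.HasArch i) (u : Fin n) :
    formSetoid c b u (joinRep b i hi u) := by
  have hst := hc.formSetoid (b := b) (hi := hi)
  have hb := formSetoid_partner_right (a := c) (b := b)
  simp only [joinRep]
  generalize formSetoid c b = R at *
  split_ifs with hu _
  · obtain rfl | rfl := hu
    · exact R.trans hst (hb _)
    · exact hb _
  · obtain rfl | rfl := hu
    · exact hb _
    · exact R.trans (R.symm hst) (hb _)
  · exact R.refl _

theorem formSetoid_le_comap_joinRep (hc : c.HasArch i) (hb : ¬ b.HasArch i) :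
    formSetoid c b ≤ (formSetoid c (b.join i hi)).comap (joinRep b i hi) := by
  have hcs := (c.hasArch_iff hi).1 hc
  have hct := hc.partner_right hi
  rw [b.hasArch_iff hi] at hb
  refine formSetoid_le (fun u => ?_) fun u => ?_
  · have left := formSetoid_partner_left (a := c) (b := b.join i hi) u
    have := c.partner_partner u
    simp only [Setoid.comap_rel, joinRep]
    generalize formSetoid c (b.join i hi) = R at *
    have := R.refl'
    grind
  · have right := formSetoid_partner_right (a := c) (b := b.join i hi)
    have := b.partner_partner u
    have := b.partner_partner ⟨i, by omega⟩
    have := b.partner_partner ⟨i + 1, hi⟩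
    simp only [Setoid.comap_rel, joinRep]
    generalize formSetoid c (b.join i hi) = R at *
    simp only [HalfDiagram.join, joinFun] at right
    have := R.refl'
    have right_u := right u
    have right_s := right (b.partner ⟨i, by omega⟩)
    have right_t := right (b.partner ⟨i + 1, hi⟩)
    have := R.symm' right_u
    have := R.symm' right_s
    have := R.symm' right_t
    clear right
    grind

theorem eq_or_eq_of_formSetoid_join (hc : c.HasArch i)
    (h : formSetoid c (b.join i hi) u ⟨i, by omega⟩) : u = ⟨i, by omega⟩ ∨ u = ⟨i + 1, hi⟩ := by
  let isEnd (u : Fin n) : Prop := u = ⟨i, by omega⟩ ∨ u = ⟨i + 1, hi⟩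
  have isEnd_partner {d : HalfDiagram n} (hd : d.HasArch i) (u : Fin n) :
      isEnd u ↔ isEnd (d.partner u) := by
    have := (d.hasArch_iff hi).1 hd
    have := hd.partner_right hi
    have := d.partner_partner u
    grind
  let S : Setoid (Fin n) := Setoid.comap isEnd ⟨Iff, ⟨Iff.refl, Iff.symm, Iff.trans⟩⟩
  have key : formSetoid c (b.join i hi) ≤ S :=
    formSetoid_le (isEnd_partner hc) (isEnd_partner (b.hasArch_join hi))
  exact (key h).2 (Or.inl rfl)

theorem exists_partner_eq_self_of_join (hc : c.HasArch i) (hu : (b.join i hi).partner u = u) :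
    ∃ w, b.partner w = w ∧ formSetoid c b u w ∧ joinRep b i hi w = u := by
  have hst := hc.formSetoid (b := b) (hi := hi)
  have hb := formSetoid_partner_right (a := c) (b := b) u
  have := b.partner_partner u
  have := b.partner_partner ⟨i, by omega⟩
  have := b.partner_partner ⟨i + 1, hi⟩
  simp only [HalfDiagram.join, joinFun] at hu
  simp only [joinRep]
  generalize formSetoid c b = R at *
  by_cases hus : b.partner u = ⟨i, by omega⟩
  · exact ⟨⟨i + 1, hi⟩, by grind, R.trans (hus ▸ hb) hst, by grind⟩
  by_cases hut : b.partner u = ⟨i + 1, hi⟩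
  · exact ⟨⟨i, by omega⟩, by grind, R.trans (hut ▸ hb) (R.symm hst), by grind⟩
  exact ⟨u, by grind, R.refl _, by grind⟩

section NotFixed

variable (hb : ¬ b.HasArch i)
  (not_fixed : ¬ (b.partner ⟨i, by omega⟩ = ⟨i, by omega⟩ ∧ b.partner ⟨i + 1, hi⟩ = ⟨i + 1, hi⟩))

include hb not_fixed

theorem join_partner_joinRep (hu : b.partner u = u) :
    (b.join i hi).partner (joinRep b i hi u) = joinRep b i hi u := by
  have := b.partner_partner ⟨i, by omega⟩
  have := b.partner_partner ⟨i + 1, hi⟩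
  rw [b.hasArch_iff hi] at hb
  simp only [joinRep, HalfDiagram.join, joinFun]
  grind

theorem joinRep_ne (u : Fin n) : joinRep b i hi u ≠ ⟨i, by omega⟩ ∧
    joinRep b i hi u ≠ ⟨i + 1, hi⟩ := by
  have := b.partner_partner ⟨i, by omega⟩
  have := b.partner_partner ⟨i + 1, hi⟩
  rw [b.hasArch_iff hi] at hb
  simp only [joinRep]
  grind

theorem formReturns_join (hc : c.HasArch i) :
    formReturns c (b.join i hi) ↔ formReturns c b := by
  have hcs := (c.hasArch_iff hi).1 hc
  have hct := hc.partner_right hi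
  have := b.partner_partner ⟨i, by omega⟩
  have := b.partner_partner ⟨i + 1, hi⟩
  constructor
  · rintro ⟨u, v, huv, h, ⟨hu, hv⟩ | ⟨hu, hv⟩⟩
    · exact ⟨u, v, huv, formSetoid_join_le hc h, Or.inl ⟨hu, hv⟩⟩
    · obtain ⟨u', hu', huu', rfl⟩ := exists_partner_eq_self_of_join hc hu
      obtain ⟨v', hv', hvv', rfl⟩ := exists_partner_eq_self_of_join hc hv
      exact ⟨u', v', ne_of_apply_ne _ huv, (formSetoid c b).trans ((formSetoid c b).symm huu')
        ((formSetoid c b).trans (formSetoid_join_le hc h) hvv'), Or.inr ⟨hu', hv'⟩⟩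
  · rintro ⟨u, v, huv, h, ⟨hu, hv⟩ | ⟨hu, hv⟩⟩
    · refine ⟨_, _, ?_, formSetoid_le_comap_joinRep hc hb h, Or.inl ?_⟩ <;>
        simp only [joinRep] <;> grind
    · refine ⟨_, _, ?_, formSetoid_le_comap_joinRep hc hb h, Or.inr
        ⟨join_partner_joinRep hb not_fixed hu, join_partner_joinRep hb not_fixed hv⟩⟩
      rw [b.hasArch_iff hi] at hb
      simp only [joinRep]
      grind

end NotFixed

/-- The connected component `x` of the graph obtained from `a` and `b` is a closed loop. -/
def IsFormLoop (a b : HalfDiagram n) (x : Quotient (formSetoid a b)) : Prop :=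
  ∀ u : Fin n, Quotient.mk _ u = x → a.partner u ≠ u ∧ b.partner u ≠ u

theorem formLoops_eq_ncard (a b : HalfDiagram n) :
    formLoops a b = {x | IsFormLoop a b x}.ncard := rfl

/-- The map induced by `joinRep` on connected components. -/
def joinComponent (hc : c.HasArch i) (hb : ¬ b.HasArch i) :
    Quotient (formSetoid c b) → Quotient (formSetoid c (b.join i hi)) :=
  Quotient.map (joinRep b i hi) fun _ _ h => formSetoid_le_comap_joinRep hc hb h

theorem joinComponent_injective (hc : c.HasArch i) (hb : ¬ b.HasArch i) :
    Function.Injective (joinComponent (hi := hi) hc hb) := by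
  refine Quotient.ind₂ fun u v h => Quotient.sound ?_
  exact (formSetoid c b).trans (formSetoid_joinRep hc u) ((formSetoid c b).trans
    (formSetoid_join_le hc (Quotient.exact h)) ((formSetoid c b).symm (formSetoid_joinRep hc v)))

theorem joinComponent_mk (hc : c.HasArch i) (hb : ¬ b.HasArch i) (hu : u ≠ ⟨i, by omega⟩)
    (hu' : u ≠ ⟨i + 1, hi⟩) : joinComponent (hi := hi) hc hb (Quotient.mk _ u) = Quotient.mk _ u :=
  congrArg (Quotient.mk _) (if_neg (not_or.2 ⟨hu, hu'⟩))

theorem isFormLoop_joinComponent_iff (hc : c.HasArch i) (hb : ¬ b.HasArch i)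
    (not_fixed : ¬ (b.partner ⟨i, by omega⟩ = ⟨i, by omega⟩ ∧
      b.partner ⟨i + 1, hi⟩ = ⟨i + 1, hi⟩)) (x : Quotient (formSetoid c b)) :
    IsFormLoop c (b.join i hi) (joinComponent hc hb x) ↔ IsFormLoop c b x := by
  have hcs := (c.hasArch_iff hi).1 hc
  have hct := hc.partner_right hi
  induction x using Quotient.inductionOn with | _ u => ?_
  constructor
  · intro hx v hv
    obtain ⟨hcv, hbv⟩ := hx (joinRep b i hi v)
      (Quotient.sound (formSetoid_le_comap_joinRep hc hb (Quotient.exact hv)))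
    refine ⟨fun hv' => hcv ?_, fun hv' => hbv (join_partner_joinRep hb not_fixed hv')⟩
    simp only [joinRep]
    grind
  · intro hx v hv
    have hvu : formSetoid c b v u := (formSetoid c b).trans
      (formSetoid_join_le hc (Quotient.exact hv)) ((formSetoid c b).symm (formSetoid_joinRep hc u))
    refine ⟨(hx v (Quotient.sound hvu)).1, fun hv' => ?_⟩
    obtain ⟨w, hw, hvw, -⟩ := exists_partner_eq_self_of_join hc hv'
    exact (hx w (Quotient.sound ((formSetoid c b).trans ((formSetoid c b).symm hvw) hvu))).2 hw

theorem isFormLoop_join (hc : c.HasArch i) :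
    IsFormLoop c (b.join i hi) (Quotient.mk _ ⟨i, by omega⟩) := by
  intro u hu
  have hb := b.hasArch_join hi
  obtain rfl | rfl := eq_or_eq_of_formSetoid_join hc (Quotient.exact hu)
  · simp [(c.hasArch_iff hi).1 hc, (HalfDiagram.hasArch_iff _ hi).1 hb]
  · simp [hc.partner_right hi, hb.partner_right hi]

theorem formLoops_join (hc : c.HasArch i) (hb : ¬ b.HasArch i)
    (not_fixed : ¬ (b.partner ⟨i, by omega⟩ = ⟨i, by omega⟩ ∧
      b.partner ⟨i + 1, hi⟩ = ⟨i + 1, hi⟩)) :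
    formLoops c (b.join i hi) = formLoops c b + 1 := by
  have components : {x | IsFormLoop c (b.join i hi) x} = insert (Quotient.mk _ ⟨i, by omega⟩)
      (joinComponent hc hb '' {x | IsFormLoop c b x}) := by
    ext x
    refine ⟨fun hx => ?_, ?_⟩
    · induction x using Quotient.inductionOn with | _ u => ?_
      by_cases hus : u = ⟨i, by omega⟩
      · exact Or.inl (congrArg _ hus)
      by_cases hut : u = ⟨i + 1, hi⟩
      · exact Or.inl (Quotient.sound (hut ▸ Setoid.symm' _ hc.formSetoid))
      have hu := joinComponent_mk hc hb hus hut
      exact Or.inr ⟨_, (isFormLoop_joinComponent_iff hc hb not_fixed _).1 (hu ▸ hx), hu⟩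
    · rintro (rfl | ⟨x, hx, rfl⟩)
      · exact isFormLoop_join hc
      · exact (isFormLoop_joinComponent_iff hc hb not_fixed x).2 hx
  have notMem : Quotient.mk _ ⟨i, by omega⟩ ∉
      joinComponent (hi := hi) hc hb '' {x | IsFormLoop c b x} := by
    rintro ⟨x, -, hx⟩
    induction x using Quotient.inductionOn with | _ u => ?_
    have := joinRep_ne hb not_fixed u
    exact (eq_or_eq_of_formSetoid_join hc (Quotient.exact hx)).elim this.1 this.2
  rw [formLoops_eq_ncard, components, Set.ncard_insert_of_notMem notMem (Set.toFinite _),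
    Set.ncard_image_of_injective _ (joinComponent_injective hc hb), formLoops_eq_ncard]

theorem HalfDiagram.HasArch.mul_formBasis (hc : c.HasArch i) (q : ℝ) (b : HalfDiagram n) :
    q * formBasis q c b = b.weight q i hi * formBasis q c (b.join i hi) := by
  rw [HalfDiagram.weight, joinWeight]
  split_ifs with hb not_fixed
  · rw [((b.hasArch_iff hi).2 hb).join_eq_self]
  · rw [formBasis, if_pos ⟨_, _, by simp, hc.formSetoid, Or.inr not_fixed⟩, mul_zero, zero_mul]
  · rw [← b.hasArch_iff hi] at hb
    rw [formBasis, formBasis, formLoops_join hc hb not_fixed,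
      propext (formReturns_join hb not_fixed hc)]
    split_ifs <;> ring

theorem continuous_formBasis (a b : HalfDiagram n) : Continuous fun q => formBasis q a b := by
  unfold formBasis
  split_ifs <;> fun_prop

theorem HalfDiagram.continuous_weight (a : HalfDiagram n) (i : ℕ) (hi : i + 1 < n) :
    Continuous fun q : ℝ => a.weight q i hi := by
  unfold HalfDiagram.weight joinWeight
  split_ifs <;> fun_prop

theorem weight_mul_formBasis_join (q : ℝ) (a b : HalfDiagram n) (hi : i + 1 < n) :
    a.weight q i hi * formBasis q (a.join i hi) b =
      b.weight q i hi * formBasis q a (b.join i hi) := by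
  -- Both sides times `q` equal `⟨e ξ_a, e ξ_b⟩`; continuity covers `q = 0`.
  have of_ne_zero (q : ℝ) (hq : q ≠ 0) : a.weight q i hi * formBasis q (a.join i hi) b =
      b.weight q i hi * formBasis q a (b.join i hi) := by
    refine mul_left_cancel₀ hq ?_
    have left := (a.hasArch_join hi).mul_formBasis (hi := hi) q b
    have right := (b.hasArch_join hi).mul_formBasis (hi := hi) q a
    rw [formBasis_symm q a, mul_left_comm, left, mul_left_comm q, right,
      formBasis_symm q (a.join i hi)]
    ring
  have continuous_left := (a.continuous_weight i hi).mul (continuous_formBasis (a.join i hi) b)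
  have continuous_right := (b.continuous_weight i hi).mul (continuous_formBasis a (b.join i hi))
  exact congrFun (continuous_left.ext_on (dense_compl_singleton 0) continuous_right of_ne_zero) q

end FormOfJoin

section SelfPairing

variable {n : ℕ} {a : HalfDiagram n} {u v : Fin n}

theorem formSetoid_self_iff : formSetoid a a u v ↔ u = v ∨ a.partner u = v := by
  let S : Setoid (Fin n) := ⟨fun u v => u = v ∨ a.partner u = v, by
    have := a.partner_partner
    constructor <;> grind⟩
  have le : formSetoid a a ≤ S := formSetoid_le (fun _ => Or.inr rfl) fun _ => Or.inr rfl
  refine ⟨fun h => le h, ?_⟩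
  rintro (rfl | rfl)
  · exact Setoid.refl' _ _
  · exact formSetoid_partner_left u

theorem formLoops_self (a : HalfDiagram n) : formLoops a a = {j | a.IsClosing j}.ncard := by
  have components :
      {x | IsFormLoop a a x} = Quotient.mk (formSetoid a a) '' {j | a.IsClosing j} := by
    ext x
    induction x using Quotient.inductionOn with | _ u => ?_
    constructor
    · intro hx
      have hne := (hx u rfl).1
      obtain h | h := hne.lt_or_gt
      · exact ⟨u, h, rfl⟩
      · have hu := formSetoid_self_iff.2 (Or.inr (a.partner_partner u))
        refine ⟨a.partner u, ?_, Quotient.sound hu⟩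
        simpa only [Set.mem_ofPred_eq, HalfDiagram.IsClosing, a.partner_partner] using h
    · rintro ⟨j, hj, hju⟩ v hv
      have hvj := formSetoid_self_iff.1 (Quotient.exact (hv.trans hju.symm))
      have := a.partner_partner v
      simp only [Set.mem_ofPred_eq, HalfDiagram.IsClosing] at hj
      grind
  have injOn : Set.InjOn (Quotient.mk (formSetoid a a)) {j | a.IsClosing j} := by
    intro j hj k hk h
    have := formSetoid_self_iff.1 (Quotient.exact h)
    have := a.partner_partner j
    simp only [Set.mem_ofPred_eq, HalfDiagram.IsClosing] at hj hk
    grind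
  rw [formLoops_eq_ncard, components, injOn.ncard_image]

theorem formBasis_self (q : ℝ) (a : HalfDiagram n) :
    formBasis q a a = q ^ {j | a.IsClosing j}.ncard := by
  have not_returns : ¬ formReturns a a := by
    rintro ⟨u, v, huv, h, fixed⟩
    have := formSetoid_self_iff.1 h
    grind
  rw [formBasis, if_neg not_returns, formLoops_self]

end SelfPairing

section Sesquilinear

variable {n : ℕ} (q : ℝ)

/-- The form as a sesquilinear map. -/
noncomputable def formMap : U n →ₗ[ℂ] U n →ₗ⋆[ℂ] ℂ :=
  LinearMap.mk₂'ₛₗ (RingHom.id ℂ) (starRingEnd ℂ) (form q)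
    (fun v v' w => by
      unfold form
      rw [Finsupp.sum_add_index' (by simp) (by
        intros
        simp only [Finsupp.sum, ← Finset.sum_add_distrib]
        congr 1
        ext
        ring)])
    (fun x v w => by
      unfold form
      rw [Finsupp.sum_smul_index' (by simp)]
      simp only [Finsupp.sum, Finset.mul_sum, smul_eq_mul, RingHom.id_apply, mul_assoc])
    (fun v w w' => by
      unfold form
      simp only [Finsupp.sum, ← Finset.sum_add_distrib]
      congr 1
      ext a
      exact Finsupp.sum_add_index' (h := fun b y => v a * conj y * (formBasis q a b : ℂ)) (by simp)
        (by intros; simp only [map_add]; ring))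
    (fun x v w => by
      unfold form
      rw [Finsupp.smul_sum]
      congr 1
      ext a y
      rw [Finsupp.sum_smul_index' (by simp), Finsupp.smul_sum]
      congr 1
      ext b z
      simp only [smul_eq_mul, map_mul]
      ring)

theorem formMap_apply (v w : U n) : formMap q v w = form q v w := rfl

theorem formMap_xi (a b : HalfDiagram n) :
    formMap q (xi a) (xi b) = (formBasis q a b : ℂ) := by
  simp [formMap_apply, form, xi]

theorem formMap_genOp (i : ℕ) (v w : U n) :
    formMap q (genOp q n i v) w = formMap q v (genOp q n i w) := by
  by_cases hi : i + 1 < n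
  · induction v using Finsupp.induction_linear with
    | zero => simp
    | add v v' h h' => simp only [map_add, LinearMap.add_apply, h, h']
    | single a x =>
      induction w using Finsupp.induction_linear with
      | zero => simp
      | add w w' h h' => simp only [map_add, h, h']
      | single b y =>
        have single_eq (a : HalfDiagram n) (x : ℂ) : Finsupp.single a x = x • xi a := by simp [xi]
        have adjoint := congrArg (fun r : ℝ => (r : ℂ)) (weight_mul_formBasis_join q a b hi)
        push_cast at adjoint
        simp only [single_eq, map_smul, map_smulₛₗ, LinearMap.smul_apply, genOp_xi q hi, formMap_xi,
          smul_eq_mul, Complex.conj_ofReal]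
        rw [adjoint]
        ring
  · simp [genOp_of_not_lt q hi]

end Sesquilinear

/-! ### Bracket words -/

/-- The height of a word of opening (`true`) and closing (`false`) brackets before letter `k`;
letters are numbered from `0`. -/
def wordHeight (f : ℕ → Bool) : ℕ → ℕ
  | 0 => 0
  | k + 1 => if f k then wordHeight f k + 1 else wordHeight f k - 1

/-- The bracket words of half-diagrams: words of `n` letters, continued by opening brackets, in
which every closing bracket has positive height, so that the truncated subtraction in
`wordHeight` is harmless. -/
structure IsWord (n : ℕ) (f : ℕ → Bool) : Prop where
  one_le : ∀ j, f j = false → 1 ≤ wordHeight f j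
  tail : ∀ j, n ≤ j → f j = true

/-- The contribution of letter `j` to the levels of a word. -/
def levelAt (f : ℕ → Bool) (j : ℕ) : Multiset ℕ := if f j then 0 else {wordHeight f j}

/-- The multiset of the heights before the closing brackets of a word. It is the restricted
sequence of the corresponding half-diagram up to order. -/
def levels (n : ℕ) (f : ℕ → Bool) : Multiset ℕ := ∑ j ∈ Finset.range n, levelAt f j

/-- The contribution to the levels of a word of all letters but `i` and `i + 1`. -/
def otherLevels (n : ℕ) (f : ℕ → Bool) (i : ℕ) : Multiset ℕ :=
  ∑ j ∈ Finset.range i, levelAt f j + ∑ j ∈ Finset.Ico (i + 2) n, levelAt f j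

/-- The letters `i` and `i + 1` form a maximum from which a box can be removed. -/
structure IsPeak (f : ℕ → Bool) (i : ℕ) : Prop where
  left : f i = true
  right : f (i + 1) = false
  one_le : 1 ≤ wordHeight f i

/-- The letters `i` and `i + 1` form a minimum, to which a box can be added. -/
structure IsValley (f : ℕ → Bool) (i : ℕ) : Prop where
  left : f i = false
  right : f (i + 1) = true
  one_le : 1 ≤ wordHeight f i

/-- The first closing bracket of the word is letter `i + 1`. -/
structure IsFirstPeak (f : ℕ → Bool) (i : ℕ) : Prop where
  eq_true : ∀ j ≤ i, f j = true
  eq_false : f (i + 1) = false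

/-- Interchange the letters `i` and `i + 1`: a box is removed from a peak or added to a valley. -/
def swapLetters (f : ℕ → Bool) (i j : ℕ) : Bool :=
  if j = i then f (i + 1) else if j = i + 1 then f i else f j

/-- Remove the letters `i` and `i + 1` and put an opening and a closing bracket in front. -/
def moveToFront (f : ℕ → Bool) (i j : ℕ) : Bool :=
  if j = 0 then true else if j = 1 then false else if j < i + 2 then f (j - 2) else f j

/-- Remove the letters `i` and `i + 1`. -/
def deleteLetters (f : ℕ → Bool) (i j : ℕ) : Bool := if j < i then f j else f (j + 2)

/-- The word `()()⋯()((⋯` with `r` closing brackets. -/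
def flatWord (r j : ℕ) : Bool := decide (2 * r ≤ j ∨ j % 2 = 0)

section Words

variable {n i j k : ℕ} {f g : ℕ → Bool}

theorem wordHeight_succ_of_true (h : f k = true) : wordHeight f (k + 1) = wordHeight f k + 1 := by
  simp [wordHeight, h]

theorem wordHeight_succ_of_false (h : f k = false) :
    wordHeight f (k + 1) = wordHeight f k - 1 := by
  simp [wordHeight, h]

theorem wordHeight_add_congr {s t : ℕ} (height_eq : wordHeight f s = wordHeight g t)
    (letter_eq : ∀ j < k, f (s + j) = g (t + j)) :
    wordHeight f (s + k) = wordHeight g (t + k) := by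
  induction k with
  | zero => exact height_eq
  | succ k ih =>
    rw [← add_assoc, ← add_assoc, wordHeight, wordHeight, ih fun j hj => letter_eq j (by omega),
      letter_eq k (by omega)]

theorem wordHeight_congr (letter_eq : ∀ j < k, f j = g j) : wordHeight f k = wordHeight g k := by
  induction k with
  | zero => rfl
  | succ k ih =>
    rw [wordHeight, wordHeight, ih fun j hj => letter_eq j (by omega), letter_eq k (by omega)]

theorem IsWord.lt (hf : IsWord n f) (hj : f j = false) : j < n := by
  by_contra h
  exact absurd (hf.tail j (by omega)) (by simp [hj])

theorem levelAt_of_true (hj : f j = true) : levelAt f j = 0 := if_pos hj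

theorem levelAt_of_false (hj : f j = false) : levelAt f j = {wordHeight f j} := by
  simp [levelAt, hj]

theorem levelAt_congr (letter_eq : f j = g k) (height_eq : wordHeight f j = wordHeight g k) :
    levelAt f j = levelAt g k := by
  rw [levelAt, levelAt, letter_eq, height_eq]

theorem mem_levels {x : ℕ} : x ∈ levels n f ↔ ∃ j < n, f j = false ∧ wordHeight f j = x := by
  simp only [levels, Multiset.mem_sum, Finset.mem_range]
  refine exists_congr fun j => and_congr_right fun _ => ?_
  cases hj : f j <;> simp [levelAt, hj, eq_comm]

theorem IsWord.wordHeight_mem_levels (hf : IsWord n f) (hj : f j = false) :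
    wordHeight f j ∈ levels n f :=
  mem_levels.2 ⟨j, hf.lt hj, hj, rfl⟩

theorem levels_eq (hi : i + 2 ≤ n) :
    levels n f = levelAt f i + levelAt f (i + 1) + otherLevels n f i := by
  rw [levels, ← Finset.sum_range_add_sum_Ico _ hi, Finset.sum_range_succ, Finset.sum_range_succ,
    otherLevels]
  abel

theorem forall_mem_levels_eq_one_iff (hf : IsWord n f) :
    (∀ x ∈ levels n f, x = 1) ↔ ∀ i, ¬ IsPeak f i := by
  constructor
  · intro h i hi
    have height_eq := h _ (hf.wordHeight_mem_levels hi.right)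
    rw [wordHeight_succ_of_true hi.left] at height_eq
    have := hi.one_le
    omega
  · intro h x hx
    obtain ⟨j, -, hj, rfl⟩ := mem_levels.1 hx
    induction j with
    | zero => exact absurd (hf.one_le 0 hj) (by simp [wordHeight])
    | succ j ih =>
      cases hfj : f j with
      | true =>
        have : ¬ 1 ≤ wordHeight f j := fun one_le => h j ⟨hfj, hj, one_le⟩
        rw [wordHeight_succ_of_true hfj]
        omega
      | false =>
        have height_eq := ih hfj (hf.wordHeight_mem_levels hfj)
        have one_le := hf.one_le _ hj
        rw [wordHeight_succ_of_false hfj] at one_le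
        omega

/-! ### Adding and removing boxes -/

theorem swapLetters_left : swapLetters f i i = f (i + 1) := by simp [swapLetters]

theorem swapLetters_right : swapLetters f i (i + 1) = f i := by simp [swapLetters]

theorem swapLetters_of_ne (h : j ≠ i) (h' : j ≠ i + 1) : swapLetters f i j = f j := by
  simp [swapLetters, h, h']

theorem swapLetters_comm (h : i + 2 ≤ j) :
    swapLetters (swapLetters f i) j = swapLetters (swapLetters f j) i := by
  ext k
  simp only [swapLetters]
  grind

theorem wordHeight_swapLetters_of_le (h : k ≤ i) :
    wordHeight (swapLetters f i) k = wordHeight f k :=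
  wordHeight_congr fun _ _ => swapLetters_of_ne (by omega) (by omega)

theorem IsPeak.wordHeight_add_two (h : IsPeak f i) : wordHeight f (i + 2) = wordHeight f i := by
  rw [wordHeight_succ_of_false h.right, wordHeight_succ_of_true h.left, Nat.add_sub_cancel]

theorem IsValley.wordHeight_add_two (h : IsValley f i) :
    wordHeight f (i + 2) = wordHeight f i := by
  rw [wordHeight_succ_of_true h.right, wordHeight_succ_of_false h.left,
    Nat.sub_add_cancel h.one_le]

theorem IsPeak.isValley (h : IsPeak f i) : IsValley (swapLetters f i) i where
  left := swapLetters_left.trans h.right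
  right := swapLetters_right.trans h.left
  one_le := (wordHeight_swapLetters_of_le le_rfl).symm ▸ h.one_le

theorem IsPeak.wordHeight_swapLetters_succ (h : IsPeak f i) :
    wordHeight (swapLetters f i) (i + 1) = wordHeight f i - 1 := by
  rw [wordHeight_succ_of_false h.isValley.left, wordHeight_swapLetters_of_le le_rfl]

theorem IsPeak.wordHeight_swapLetters_of_ge (h : IsPeak f i) (hk : i + 2 ≤ k) :
    wordHeight (swapLetters f i) k = wordHeight f k := by
  obtain ⟨l, rfl⟩ := Nat.exists_eq_add_of_le hk
  refine wordHeight_add_congr ?_ fun j _ => swapLetters_of_ne (by omega) (by omega)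
  rw [h.isValley.wordHeight_add_two, wordHeight_swapLetters_of_le le_rfl, h.wordHeight_add_two]

theorem IsPeak.wordHeight_swapLetters_of_ne (h : IsPeak f i) (hk : k ≠ i + 1) :
    wordHeight (swapLetters f i) k = wordHeight f k := by
  rcases Nat.lt_or_ge k (i + 1) with hlt | hge
  · exact wordHeight_swapLetters_of_le (by omega)
  · exact h.wordHeight_swapLetters_of_ge (by omega)

theorem IsPeak.isWord (h : IsPeak f i) (hf : IsWord n f) : IsWord n (swapLetters f i) where
  one_le j hj := by
    rcases eq_or_ne j i with rfl | hji
    · exact h.isValley.one_le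
    have hji' : j ≠ i + 1 := by
      rintro rfl
      simp [h.isValley.right] at hj
    rw [swapLetters_of_ne hji hji'] at hj
    rw [h.wordHeight_swapLetters_of_ne hji']
    exact hf.one_le j hj
  tail j hj := by
    have := hf.lt h.right
    rw [swapLetters_of_ne (by omega) (by omega), hf.tail j hj]

protected theorem IsPeak.swapLetters (h : IsPeak f i) (hj : IsPeak f j)
    (hij : i + 2 ≤ j ∨ j + 2 ≤ i) : IsPeak (swapLetters f i) j where
  left := (swapLetters_of_ne (by omega) (by omega)).trans hj.left
  right := (swapLetters_of_ne (by omega) (by omega)).trans hj.right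
  one_le := (h.wordHeight_swapLetters_of_ne (k := j) (by omega)).symm ▸ hj.one_le

theorem IsPeak.eq_or_apart (h : IsPeak f i) (hj : IsPeak f j) :
    i = j ∨ i + 2 ≤ j ∨ j + 2 ≤ i := by
  have : j ≠ i + 1 := by rintro rfl; exact absurd hj.left (by simp [h.right])
  have : i ≠ j + 1 := by rintro rfl; exact absurd h.left (by simp [hj.right])
  omega

theorem IsPeak.levels_eq_cons (h : IsPeak f i) (hf : IsWord n f) :
    levels n f = (wordHeight f i + 1) ::ₘ otherLevels n f i := by
  rw [levels_eq (hf.lt h.right), levelAt_of_true h.left, levelAt_of_false h.right,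
    wordHeight_succ_of_true h.left, zero_add, Multiset.singleton_add]

theorem IsPeak.otherLevels_swapLetters (h : IsPeak f i) :
    otherLevels n (swapLetters f i) i = otherLevels n f i := by
  have levelAt_eq : ∀ j, j < i ∨ i + 2 ≤ j →
      levelAt (swapLetters f i) j = levelAt f j := fun j hj =>
    levelAt_congr (swapLetters_of_ne (by omega) (by omega))
      (h.wordHeight_swapLetters_of_ne (by omega))
  refine congrArg₂ (· + ·) (Finset.sum_congr rfl fun j hj => levelAt_eq j ?_)
    (Finset.sum_congr rfl fun j hj => levelAt_eq j ?_)
  · exact .inl (Finset.mem_range.1 hj)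
  · exact .inr (Finset.mem_Ico.1 hj).1

theorem IsPeak.levels_swapLetters (h : IsPeak f i) (hf : IsWord n f) :
    levels n (swapLetters f i) = wordHeight f i ::ₘ otherLevels n f i := by
  rw [levels_eq (hf.lt h.right), levelAt_of_false h.isValley.left,
    levelAt_of_true h.isValley.right, wordHeight_swapLetters_of_le le_rfl, add_zero,
    Multiset.singleton_add, h.otherLevels_swapLetters]

theorem IsPeak.sum_levels_lt (h : IsPeak f i) (hf : IsWord n f) :
    (levels n (swapLetters f i)).sum < (levels n f).sum := by
  rw [h.levels_eq_cons hf, h.levels_swapLetters hf, Multiset.sum_cons, Multiset.sum_cons]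
  omega

theorem IsWord.box_induction {motive : (ℕ → Bool) → Prop}
    (flat : ∀ f, IsWord n f → (∀ i, ¬ IsPeak f i) → motive f)
    (box : ∀ f i, IsWord n f → IsPeak f i →
      (∀ g, IsWord n g → (levels n g).sum < (levels n f).sum → motive g) → motive f)
    (hf : IsWord n f) : motive f := by
  induction hs : (levels n f).sum using Nat.strong_induction_on generalizing f with
  | _ s ih =>
    subst hs
    by_cases hpeak : ∃ i, IsPeak f i
    · obtain ⟨i, hi⟩ := hpeak
      exact box f i hf hi fun g hg hlt => ih _ hlt hg rfl
    · exact flat f hf (not_exists.1 hpeak)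

/-! ### Moving a valley to the front -/

theorem wordHeight_moveToFront_of_le (h : k ≤ i) :
    wordHeight (moveToFront f i) (k + 2) = wordHeight f k := by
  have := wordHeight_add_congr (f := moveToFront f i) (g := f) (s := 2) (t := 0) (k := k)
    (by simp [wordHeight, moveToFront]) fun j hj => by simp only [moveToFront]; grind
  rwa [add_comm, zero_add] at this

theorem IsValley.wordHeight_moveToFront_of_ge (h : IsValley f i) (hk : i + 2 ≤ k) :
    wordHeight (moveToFront f i) k = wordHeight f k := by
  obtain ⟨l, rfl⟩ := Nat.exists_eq_add_of_le hk
  refine wordHeight_add_congr ?_ fun j _ => by simp only [moveToFront]; grind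
  rw [wordHeight_moveToFront_of_le le_rfl, h.wordHeight_add_two]

theorem IsValley.isWord_moveToFront (h : IsValley f i) (hf : IsWord n f) (hi : i + 2 ≤ n) :
    IsWord n (moveToFront f i) where
  one_le j hj := by
    rcases Nat.lt_or_ge j (i + 2) with hlt | hge
    · match j with
      | 0 => simp [moveToFront] at hj
      | 1 => simp [wordHeight, moveToFront]
      | j + 2 =>
        rw [wordHeight_moveToFront_of_le (by omega)]
        refine hf.one_le j ?_
        simpa [moveToFront, show j < i by omega] using hj
    · rw [h.wordHeight_moveToFront_of_ge hge]
      refine hf.one_le j ?_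
      simp only [moveToFront] at hj
      grind
  tail j hj := by
    have := hf.tail j hj
    simp only [moveToFront]
    grind

theorem IsValley.levels_moveToFront (h : IsValley f i) (hi : i + 2 ≤ n) :
    levels n (moveToFront f i) = 1 ::ₘ otherLevels n f i := by
  have before : ∀ j ∈ Finset.range i, levelAt (moveToFront f i) (j + 1 + 1) = levelAt f j := by
    intro j hj
    have hj := Finset.mem_range.1 hj
    exact levelAt_congr (by simp [moveToFront, hj]) (wordHeight_moveToFront_of_le hj.le)
  have after : ∀ j ∈ Finset.Ico (i + 2) n, levelAt (moveToFront f i) j = levelAt f j := by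
    intro j hj
    have hj := (Finset.mem_Ico.1 hj).1
    exact levelAt_congr (by simp only [moveToFront]; grind) (h.wordHeight_moveToFront_of_ge hj)
  have front : levelAt (moveToFront f i) 1 = {1} := levelAt_of_false rfl
  rw [levels, ← Finset.sum_range_add_sum_Ico _ hi, Finset.sum_range_succ', Finset.sum_range_succ',
    Finset.sum_congr rfl before, Finset.sum_congr rfl after, zero_add, front,
    levelAt_of_true rfl, otherLevels, ← Multiset.singleton_add]
  abel

/-! ### Removing the first peak -/

theorem exists_isFirstPeak (first : f 0 = true) (h : ∃ j, f j = false) :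
    ∃ i, IsFirstPeak f i := by
  have find_ne_zero : Nat.find h ≠ 0 := by
    intro h_zero
    have := Nat.find_spec h
    simp [h_zero, first] at this
  obtain ⟨i, hi⟩ := Nat.exists_eq_succ_of_ne_zero find_ne_zero
  refine ⟨i, fun j hj => ?_, by rw [← Nat.succ_eq_add_one, ← hi]; exact Nat.find_spec h⟩
  simpa using Nat.find_min h (m := j) (by omega)

namespace IsFirstPeak

theorem wordHeight_eq_self (h : IsFirstPeak f i) (hk : k ≤ i + 1) : wordHeight f k = k := by
  induction k with
  | zero => rfl
  | succ k ih => rw [wordHeight_succ_of_true (h.eq_true k (by omega)), ih (by omega)]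

theorem wordHeight_deleteLetters (h : IsFirstPeak f i) (hk : i ≤ k) :
    wordHeight (deleteLetters f i) k = wordHeight f (k + 2) := by
  obtain ⟨l, rfl⟩ := Nat.exists_eq_add_of_le hk
  rw [Nat.add_right_comm]
  refine wordHeight_add_congr ?_ fun j _ => ?_
  · rw [wordHeight_congr (g := f) (f := deleteLetters f i) fun j hj => if_pos hj,
      wordHeight_succ_of_false h.eq_false,
      h.wordHeight_eq_self le_rfl, h.wordHeight_eq_self (by omega), Nat.add_sub_cancel]
  · rw [deleteLetters, if_neg (by omega), Nat.add_right_comm]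

theorem isWord (h : IsFirstPeak f i) (hi : i ≤ n) (hf : IsWord n (deleteLetters f i)) :
    IsWord (n + 2) f where
  one_le j hj := by
    rcases Nat.lt_or_ge i j with hij | hji
    · obtain rfl | ⟨k, rfl⟩ : j = i + 1 ∨ ∃ k, j = i + k + 2 :=
        (Nat.exists_eq_add_of_lt hij).elim fun k hk => by
          cases k with
          | zero => exact .inl hk
          | succ k => exact .inr ⟨k, by omega⟩
      · rw [h.wordHeight_eq_self le_rfl]
        omega
      · rw [← h.wordHeight_deleteLetters (by omega)]
        refine hf.one_le _ ?_
        rw [deleteLetters, if_neg (by omega), hj]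
    · exact absurd (h.eq_true j hji) (by simp [hj])
  tail j hj := by
    obtain ⟨k, rfl⟩ := Nat.exists_eq_add_of_le' (by omega : 2 ≤ j)
    rw [← hf.tail k (by omega), deleteLetters, if_neg (by omega)]

theorem levels_eq_cons (h : IsFirstPeak f i) (hi : i ≤ n) :
    levels (n + 2) f = (i + 1) ::ₘ levels n (deleteLetters f i) := by
  have before : ∀ j ∈ Finset.range i, levelAt f j = 0 := fun j hj =>
    levelAt_of_true (h.eq_true j (Finset.mem_range.1 hj).le)
  have before' : ∀ j ∈ Finset.range i, levelAt (deleteLetters f i) j = 0 := fun j hj =>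
    levelAt_of_true ((if_pos (Finset.mem_range.1 hj)).trans
      (h.eq_true j (Finset.mem_range.1 hj).le))
  have after : ∀ j ∈ Finset.Ico i n, levelAt (deleteLetters f i) j = levelAt f (j + 2) :=
    fun j hj => levelAt_congr (if_neg (Finset.mem_Ico.1 hj).1.not_gt)
      (h.wordHeight_deleteLetters (Finset.mem_Ico.1 hj).1)
  rw [levels_eq (i := i) (by omega), otherLevels, levelAt_of_true (h.eq_true i le_rfl),
    levelAt_of_false h.eq_false, h.wordHeight_eq_self le_rfl, Finset.sum_eq_zero before, zero_add,
    zero_add, Multiset.singleton_add, levels, ← Finset.sum_range_add_sum_Ico _ hi,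
    Finset.sum_eq_zero before', zero_add, Finset.sum_congr rfl after,
    Finset.sum_Ico_add' (levelAt f)]

end IsFirstPeak

/-! ### Words without peaks -/

theorem IsWord.eq_true_of_two_le (hf : IsWord n f) (no_peak : ∀ i, ¬ IsPeak f i)
    (hk : 2 ≤ wordHeight f k) : f k = true := by
  by_contra h
  have := (forall_mem_levels_eq_one_iff hf).2 no_peak _
    (hf.wordHeight_mem_levels (by simpa using h))
  omega

theorem IsWord.eq_true_of_two_le_of_le (hf : IsWord n f) (no_peak : ∀ i, ¬ IsPeak f i)
    (hk : 2 ≤ wordHeight f k) (hkj : k ≤ j) : f j = true := by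
  refine hf.eq_true_of_two_le no_peak ?_
  induction j, hkj using Nat.le_induction with
  | base => exact hk
  | succ j _ ih =>
    rw [wordHeight_succ_of_true (hf.eq_true_of_two_le no_peak ih)]
    omega

theorem IsWord.eq_true_of_wordHeight_eq_zero (hf : IsWord n f) (h : wordHeight f k = 0) :
    f k = true := by
  by_contra hk
  have := hf.one_le k (by simpa using hk)
  omega

theorem IsWord.wordHeight_two_mul_eq_zero (hf : IsWord n f) {r : ℕ}
    (odd_false : ∀ m < r, f (2 * m + 1) = false) : wordHeight f (2 * r) = 0 := by
  induction r with
  | zero => rfl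
  | succ r ih =>
    have ih := ih fun m hm => odd_false m (by omega)
    rw [Nat.mul_succ, wordHeight_succ_of_false (odd_false r (by omega)),
      wordHeight_succ_of_true (hf.eq_true_of_wordHeight_eq_zero ih), ih]

theorem IsWord.exists_eq_flatWord (hf : IsWord n f) (no_peak : ∀ i, ¬ IsPeak f i) :
    ∃ r, 2 * r ≤ n ∧ f = flatWord r := by
  classical
  have exists_true : ∃ r, f (2 * r + 1) = true := ⟨n, hf.tail _ (by omega)⟩
  obtain ⟨r, r_true, r_min⟩ : ∃ r, f (2 * r + 1) = true ∧ ∀ m < r, f (2 * m + 1) = false :=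
    ⟨Nat.find exists_true, Nat.find_spec exists_true, fun m hm => by
      simpa using Nat.find_min exists_true hm⟩
  have height_zero : ∀ m ≤ r, wordHeight f (2 * m) = 0 := fun m hm =>
    hf.wordHeight_two_mul_eq_zero fun l hl => r_min l (by omega)
  have even_true : ∀ m ≤ r, f (2 * m) = true := fun m hm =>
    hf.eq_true_of_wordHeight_eq_zero (height_zero m hm)
  have tail_true : ∀ j, 2 * r + 2 ≤ j → f j = true := fun j hj =>
    hf.eq_true_of_two_le_of_le no_peak (by
      rw [wordHeight_succ_of_true r_true, wordHeight_succ_of_true (even_true r le_rfl)]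
      omega) hj
  refine ⟨r, ?_, ?_⟩
  · cases r with
    | zero => omega
    | succ r => exact hf.lt (r_min r (by omega))
  · ext j
    obtain ⟨m, rfl | rfl⟩ := Nat.even_or_odd' j
    · grind [flatWord]
    · grind [flatWord]

theorem moveToFront_flatWord {r s : ℕ} (hs : s < r) :
    moveToFront (flatWord r) (2 * s + 1) = flatWord r := by
  ext j
  simp only [moveToFront, flatWord]
  grind

end Words

/-! ### The bracket word of a half-diagram -/

theorem card_filter_eq_add_wordHeight {n k : ℕ} {f : ℕ → Bool} (hf : IsWord n f) :
    ((Finset.range k).filter fun j => f j = true).card =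
      ((Finset.range k).filter fun j => f j = false).card + wordHeight f k := by
  induction k with
  | zero => rfl
  | succ k ih =>
    rw [Finset.range_add_one, Finset.filter_insert, Finset.filter_insert]
    cases hk : f k with
    | true =>
      rw [if_pos rfl, if_neg (by simp), Finset.card_insert_of_notMem (by simp), ih,
        wordHeight_succ_of_true hk]
      omega
    | false =>
      have := hf.one_le k hk
      rw [if_neg (by simp), if_pos rfl, Finset.card_insert_of_notMem (by simp), ih,
        wordHeight_succ_of_false hk]
      omega

theorem card_filter_lt_and {n k : ℕ} (hk : k ≤ n) (P : ℕ → Prop) [DecidablePred P] :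
    (Finset.univ.filter fun j : Fin n => j.1 < k ∧ P j).card =
      ((Finset.range k).filter P).card := by
  rw [← Finset.card_map Fin.valEmbedding]
  congr 1
  ext j
  simp only [Finset.mem_map, Finset.mem_filter, Finset.mem_univ, true_and, Finset.mem_range,
    Fin.valEmbedding_apply]
  exact ⟨by rintro ⟨j, hj, rfl⟩; exact hj, fun hj => ⟨⟨j, by omega⟩, hj, rfl⟩⟩

namespace HalfDiagram

variable {n : ℕ} {a b : HalfDiagram n} {i j : ℕ}

open Classical in
/-- The word whose letter `j` is `false` if bracket `j` of the half-diagram is closing; it is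
continued by opening brackets. -/
noncomputable def word (a : HalfDiagram n) (j : ℕ) : Bool :=
  decide (¬ ∃ h : j < n, a.IsClosing ⟨j, h⟩)

theorem word_eq_false : a.word j = false ↔ ∃ h : j < n, a.IsClosing ⟨j, h⟩ := by
  simp [word]

theorem word_eq_true : a.word j = true ↔ ∀ h : j < n, ¬ a.IsClosing ⟨j, h⟩ := by
  simp [word]

theorem isClosing_iff (k : Fin n) : a.IsClosing k ↔ a.word k = false := by
  simp [word_eq_false]

theorem isClosing_partner {k : Fin n} (h : k < a.partner k) : a.IsClosing (a.partner k) := by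
  rwa [IsClosing, a.partner_partner]

theorem hasArch_of_word (left : a.word i = true) (right : a.word (i + 1) = false) :
    a.HasArch i := by
  obtain ⟨hi, closing⟩ := word_eq_false.1 right
  have opening := word_eq_true.1 left (by omega)
  refine (a.hasArch_iff hi).2 ?_
  by_contra not_arch
  have partner_lt : a.partner ⟨i + 1, hi⟩ < ⟨i, by omega⟩ := by
    have : a.partner ⟨i + 1, hi⟩ ≠ ⟨i, by omega⟩ := fun h =>
      not_arch (by rw [← h, a.partner_partner])
    rw [IsClosing, Fin.lt_def] at closing
    rw [ne_eq, Fin.ext_iff] at this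
    rw [Fin.lt_def]
    simp only at *
    omega
  obtain ⟨-, h_lt, h_ne⟩ := a.partner_noncrossing partner_lt (by
    rw [a.partner_partner, Fin.lt_def]; simp)
  rw [a.partner_partner, Fin.lt_def] at h_lt
  refine opening (lt_of_le_of_ne ?_ h_ne)
  rw [Fin.le_def]
  simp only at *
  omega

theorem HasArch.word_right (h : a.HasArch i) : a.word (i + 1) = false := by
  refine word_eq_false.2 ⟨h.1, ?_⟩
  simp [IsClosing, h.partner_right h.1]

/-! ### A half-diagram is determined by its word -/

theorem not_partner_lt_partner (isClosing_iff : ∀ k, a.IsClosing k ↔ b.IsClosing k) {j : Fin n}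
    (hj : b.IsClosing j) (ih : ∀ k < j, a.IsClosing k → a.partner k = b.partner k) :
    ¬ a.partner j < b.partner j := by
  intro hlt
  have inside := a.partner_noncrossing hlt (by rw [a.partner_partner]; exact hj)
  rw [a.partner_partner] at inside
  obtain ⟨-, partner_lt, partner_ne⟩ := inside
  have opening : ¬ a.IsClosing (b.partner j) := by
    rw [isClosing_iff, IsClosing, b.partner_partner]
    exact hj.asymm
  have partner_eq := ih _ partner_lt
    (isClosing_partner (lt_of_le_of_ne (not_lt.1 opening) partner_ne.symm))
  rw [a.partner_partner] at partner_eq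
  exact partner_lt.ne (b.partner_involutive.injective partner_eq).symm

theorem partner_eq_of_isClosing (isClosing_iff : ∀ k, a.IsClosing k ↔ b.IsClosing k) {j : Fin n}
    (hj : a.IsClosing j) : a.partner j = b.partner j := by
  induction j using WellFoundedLT.induction with
  | _ j ih =>
    refine le_antisymm (not_lt.1 ?_) (not_lt.1 ?_)
    · exact not_partner_lt_partner (fun k => (isClosing_iff k).symm) hj fun k hk hk' =>
        (ih k hk ((isClosing_iff k).2 hk')).symm
    · exact not_partner_lt_partner isClosing_iff ((isClosing_iff j).1 hj) ih

theorem word_injective : Function.Injective (word : HalfDiagram n → ℕ → Bool) := by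
  intro a b hab
  have closing_iff : ∀ k, a.IsClosing k ↔ b.IsClosing k := fun k => by
    rw [isClosing_iff, isClosing_iff, hab]
  ext j : 2
  by_cases hj : a.IsClosing j
  · exact partner_eq_of_isClosing closing_iff hj
  have hj' := mt (closing_iff j).2 hj
  rcases (not_lt.1 hj).lt_or_eq with hlt | heq
  · have := partner_eq_of_isClosing closing_iff (isClosing_partner hlt)
    rw [← b.partner_involutive.eq_iff, ← this, a.partner_partner]
  rcases (not_lt.1 hj').lt_or_eq with hlt' | heq'
  · have := partner_eq_of_isClosing (fun k => (closing_iff k).symm) (isClosing_partner hlt')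
    rw [a.partner_involutive.eq_iff, ← this, b.partner_partner]
  · rw [← heq, ← heq']

/-! ### The restricted sequence and the heights in terms of words -/

theorem word_removeArch (a : HalfDiagram (n + 2)) (h : a.HasArch i) :
    (a.removeArch i h).word = deleteLetters a.word i := by
  have closing_iff : ∀ j : Fin n, (a.removeArch i h).IsClosing j ↔ a.IsClosing (skip i j) := by
    intro j
    rw [IsClosing, IsClosing, ← skip_removePartner a i h, skip_lt_skip]
    rfl
  have hi := h.1
  ext j
  rw [Bool.eq_iff_iff, word_eq_true, deleteLetters]
  split_ifs with hji
  · simp only [word_eq_true, show j < n by omega, show j < n + 2 by omega, forall_true_left,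
      closing_iff, skip, hji, if_true]
  · simp only [word_eq_true, Nat.add_lt_add_iff_right, closing_iff, skip, hji, if_false]

theorem word_zero (a : HalfDiagram n) : a.word 0 = true :=
  word_eq_true.2 fun _ => by simp [IsClosing, Fin.lt_def]

theorem isFirstPeak_word (h : a.HasArch i) (hmin : ∀ j < i, ¬ a.HasArch j) :
    IsFirstPeak a.word i where
  eq_true j hj := by
    induction j with
    | zero => exact a.word_zero
    | succ j ih =>
      by_contra hne
      exact hmin j (by omega) (hasArch_of_word (ih (by omega)) (by simpa using hne))
  eq_false := h.word_right

theorem word_eq_true_of_forall_not_hasArch (h : ∀ i, ¬ a.HasArch i) (j : ℕ) :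
    a.word j = true := by
  by_contra hj
  obtain ⟨i, hi⟩ := exists_isFirstPeak a.word_zero ⟨j, by simpa using hj⟩
  exact h i (hasArch_of_word (hi.eq_true i le_rfl) hi.eq_false)

open Classical in
theorem isWord_and_restrictedSequence {n : ℕ} (a : HalfDiagram n) :
    IsWord n a.word ∧ (a.restrictedSequence : Multiset ℕ) = levels n a.word := by
  induction n using Nat.strong_induction_on with | _ n ih => ?_
  by_cases h : ∃ i, a.HasArch i
  · have first_peak := isFirstPeak_word (Nat.find_spec h) fun j hj => Nat.find_min h hj
    obtain ⟨hi, -⟩ := Nat.find_spec h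
    match n, a with
    | 0, _ => omega
    | 1, _ => omega
    | n + 2, a =>
      obtain ⟨isWord, levels_eq⟩ :=
        ih n (by omega) (a.removeArch (Nat.find h) (Nat.find_spec h))
      rw [word_removeArch] at isWord levels_eq
      refine ⟨first_peak.isWord (by omega) isWord, ?_⟩
      rw [first_peak.levels_eq_cons (by omega), ← levels_eq, restrictedSequence, dif_pos h,
        Multiset.cons_coe]
  · have all_true := word_eq_true_of_forall_not_hasArch (not_exists.1 h)
    refine ⟨⟨fun j hj => by simp [all_true] at hj, fun j _ => all_true j⟩, ?_⟩
    rw [levels, Finset.sum_eq_zero fun j _ => levelAt_of_true (all_true j)]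
    match n, a with
    | 0, _ => rfl
    | 1, _ => rfl
    | n + 2, a => rw [restrictedSequence, dif_neg h, Multiset.coe_nil]

theorem isWord_word (a : HalfDiagram n) : IsWord n a.word := (isWord_and_restrictedSequence a).1

theorem coe_restrictedSequence (a : HalfDiagram n) :
    (a.restrictedSequence : Multiset ℕ) = levels n a.word := (isWord_and_restrictedSequence a).2

theorem isMinimal_iff (a : HalfDiagram n) : a.IsMinimal ↔ ∀ i, ¬ IsPeak a.word i := by
  rw [← forall_mem_levels_eq_one_iff a.isWord_word, ← coe_restrictedSequence]
  rfl

theorem height_eq (a : HalfDiagram n) {k : ℕ} (hk : k ≤ n) : a.height k = wordHeight a.word k := by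
  rw [height]
  simp only [isClosing_iff, Bool.not_eq_false]
  rw [card_filter_lt_and hk fun j => a.word j = true,
    card_filter_lt_and hk fun j => a.word j = false,
    card_filter_eq_add_wordHeight a.isWord_word, Nat.add_sub_cancel_left]

theorem card_levels_word (a : HalfDiagram n) :
    (levels n a.word).card = {j | a.IsClosing j}.ncard := by
  classical
  rw [Set.ncard_eq_toFinset_card', Set.toFinset_ofPred, Finset.card_filter, levels,
    Multiset.card_sum, Finset.sum_range]
  refine Finset.sum_congr rfl fun j _ => ?_
  rw [isClosing_iff, levelAt]
  cases a.word j <;> simp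

/-! ### Box additions and the existence of half-diagrams with given words -/

theorem isBoxAddition_iff (hi : i + 1 < n) :
    IsBoxAddition i hi a b ↔ IsPeak b.word i ∧ a.word = swapLetters b.word i := by
  simp only [IsBoxAddition, isClosing_iff, Bool.not_eq_false]
  constructor
  · rintro ⟨a_left, a_right, b_left, b_right, others⟩
    have word_eq : a.word = swapLetters b.word i := by
      ext j
      rw [swapLetters]
      split_ifs with h h'
      · rw [h, a_left, b_right]
      · rw [h', a_right, b_left]
      · by_cases hj : j < n
        · have := others ⟨j, hj⟩ h h'
          grind
        · rw [a.isWord_word.tail j (by omega), b.isWord_word.tail j (by omega)]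
    refine ⟨⟨b_left, b_right, ?_⟩, word_eq⟩
    rw [← wordHeight_swapLetters_of_le (i := i) le_rfl, ← word_eq]
    exact a.isWord_word.one_le i a_left
  · rintro ⟨peak, word_eq⟩
    rw [word_eq]
    exact ⟨peak.isValley.left, peak.isValley.right, peak.left, peak.right, fun j h h' => by
      rw [swapLetters_of_ne h h']⟩

theorem word_join (h : IsValley a.word i) (hi : i + 1 < n) :
    (a.join i hi).word = swapLetters a.word i := by
  have left : a.partner ⟨i, by omega⟩ < ⟨i, by omega⟩ := (isClosing_iff _).2 h.left
  have right : ⟨i + 1, hi⟩ ≤ a.partner ⟨i + 1, hi⟩ := not_lt.1 (word_eq_true.1 h.right hi)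
  have hlt : (⟨i, by omega⟩ : Fin n) < ⟨i + 1, hi⟩ := by simp [Fin.lt_def]
  have adjacent (k : Fin n) : k ≤ ⟨i, by omega⟩ ∨ ⟨i + 1, hi⟩ ≤ k := by
    simp only [Fin.le_def]; omega
  have closing_iff (k : Fin n) : (a.join i hi).IsClosing k ↔
      k = ⟨i + 1, hi⟩ ∨ k ≠ ⟨i, by omega⟩ ∧ a.IsClosing k := by
    have := adjacent k
    have := a.partner_partner k
    have := a.partner_partner ⟨i, by omega⟩
    have := a.partner_partner ⟨i + 1, hi⟩
    simp only [IsClosing, join, joinFun]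
    generalize (⟨i, by omega⟩ : Fin n) = s at *
    generalize (⟨i + 1, hi⟩ : Fin n) = t at *
    grind
  ext k
  rw [Bool.eq_iff_iff, word_eq_true]
  simp only [closing_iff, isClosing_iff, swapLetters, Fin.ext_iff]
  have := h.left
  have := h.right
  have := a.isWord_word.tail k
  grind

/-- The half-diagram with arches `{0, 1}, {2, 3}, …, {2r - 2, 2r - 1}`. -/
def flat (n r : ℕ) (hr : 2 * r ≤ n) : HalfDiagram n where
  partner j := ⟨if j < 2 * r then if j.1 % 2 = 0 then j + 1 else j - 1 else j, by grind⟩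
  partner_partner j := by ext; simp only; grind
  noncrossing j k := by simp only [Fin.lt_def]; grind
  noncrossing_through j k := by simp only [Fin.lt_def, Fin.ext_iff]; grind

variable {r : ℕ} (hr : 2 * r ≤ n)

theorem word_flat : (flat n r hr).word = flatWord r := by
  ext j
  rw [Bool.eq_iff_iff, word_eq_true]
  simp only [IsClosing, flat, Fin.lt_def, flatWord, decide_eq_true_iff]
  grind

theorem hasArch_flat {s : ℕ} (hs : s < r) : (flat n r hr).HasArch (2 * s) :=
  (hasArch_iff _ (by omega)).2 (by ext; simp only [flat]; grind)

theorem weight_flat_eq_zero {R : Type*} [CommMonoidWithZero R] (q : R) (hi : i + 1 < n)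
    (hri : 2 * r ≤ i) : (flat n r hr).weight q i hi = 0 := by
  simp only [weight, joinWeight, flat, Fin.ext_iff]
  grind

theorem exists_word_eq {f : ℕ → Bool} (hf : IsWord n f) : ∃ a : HalfDiagram n, a.word = f := by
  refine hf.box_induction (motive := fun f => ∃ a : HalfDiagram n, a.word = f)
    (fun f hf no_peak => ?_) fun f i hf peak ih => ?_
  · obtain ⟨r, hr, rfl⟩ := hf.exists_eq_flatWord no_peak
    exact ⟨flat n r hr, word_flat hr⟩
  · obtain ⟨a, ha⟩ := ih _ (peak.isWord hf) (peak.sum_levels_lt hf)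
    refine ⟨a.join i (hf.lt peak.right), ?_⟩
    rw [word_join (ha ▸ peak.isValley), ha]
    ext j
    simp only [swapLetters]
    grind

end HalfDiagram

/-! ### Products of generators -/

section GeneratorProducts

variable {n : ℕ} (q : ℝ) {i j k : ℕ}

variable (n) in
/-- The product `e_1 ⋯ e_i`. It transports an arch at the points `i` and `i + 1` to the front. -/
noncomputable def genProd : ℕ → Module.End ℂ (U n)
  | 0 => 1
  | i + 1 => genProd i * genOp q n i

theorem genProd_succ : genProd n q (i + 1) = genProd n q i * genOp q n i := rfl

theorem commute_genProd_genOp (h : j + 1 ≤ k) : Commute (genProd n q j) (genOp q n k) := by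
  induction j with
  | zero => exact Commute.one_left _
  | succ j ih => exact (ih (by omega)).mul_left (commute_genOp q h)

theorem genProd_add_two_mul_genOp (hk : k + 2 < n) :
    genProd n q (k + 2) * genOp q n k = genProd n q (k + 1) := by
  rw [genProd_succ, genProd_succ, mul_assoc, mul_assoc, ← mul_assoc (genOp q n k),
    genOp_mul_genOp_succ_mul_genOp q hk]

theorem genProd_mul_genOp (hji : j + 2 ≤ i) (hi : i + 1 < n) :
    genProd n q (i + 1) * genOp q n j = genOp q n (j + 2) * genProd n q (i + 1) := by
  induction i, hji using Nat.le_induction with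
  | base =>
    have far : genOp q n (j + 2) * genOp q n j = genOp q n j * genOp q n (j + 2) :=
      (commute_genOp q le_rfl).eq.symm
    calc genProd n q (j + 2) * genOp q n (j + 2) * genOp q n j
        = genProd n q (j + 2) * genOp q n j * genOp q n (j + 2) := by
          rw [mul_assoc, far, mul_assoc]
      _ = genProd n q j * genOp q n j * genOp q n (j + 2) := by
          rw [genProd_add_two_mul_genOp q (by omega), genProd_succ]
      _ = genProd n q j * genOp q n j *
            (genOp q n (j + 2) * genOp q n (j + 1) * genOp q n (j + 2)) := by
          rw [genOp_succ_mul_genOp_mul_genOp_succ]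
      _ = genProd n q j * genOp q n (j + 2) * genOp q n j * genOp q n (j + 1) *
            genOp q n (j + 2) := by
          rw [mul_assoc (genProd n q j) (genOp q n (j + 2)), far]
          simp only [mul_assoc]
      _ = genOp q n (j + 2) * (genProd n q (j + 2) * genOp q n (j + 2)) := by
          rw [(commute_genProd_genOp q (by omega)).eq]
          simp only [genProd_succ, mul_assoc]
  | succ i hji ih =>
    rw [genProd_succ, mul_assoc, ← (commute_genOp q (by omega)).eq, ← mul_assoc, ih (by omega),
      mul_assoc]

theorem formMap_genOp_self (v : U n) :
    formMap q (genOp q n i v) (genOp q n i v) = q * formMap q (genOp q n i v) v := by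
  rw [← formMap_genOp, ← Module.End.mul_apply, genOp_mul_self, LinearMap.smul_apply, map_smul,
    LinearMap.smul_apply, smul_eq_mul]

theorem formMap_genProd_self (hi : i + 1 < n) (v : U n) :
    formMap q (genProd n q (i + 1) v) (genProd n q (i + 1) v) =
      q * formMap q (genOp q n i v) v := by
  induction i generalizing v with
  | zero => exact formMap_genOp_self q v
  | succ i ih =>
    have braid := LinearMap.congr_fun (genOp_succ_mul_genOp_mul_genOp_succ q (n := n) (i := i)) v
    simp only [Module.End.mul_apply] at braid
    rw [genProd_succ, Module.End.mul_apply, ih (by omega), ← formMap_genOp, braid]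

end GeneratorProducts

/-! ### The second basis, indexed by words -/

section WordVec

variable {n : ℕ} (q : ℝ) {i j r : ℕ} {f : ℕ → Bool}

open Classical in
/-- The basis vector of the half-diagram on `n` points with a given word, and `0` if there is no
such half-diagram. -/
noncomputable def xiOfWord (n : ℕ) (f : ℕ → Bool) : U n :=
  if h : ∃ a : HalfDiagram n, a.word = f then xi h.choose else 0

theorem xiOfWord_word (a : HalfDiagram n) : xiOfWord n a.word = xi a := by
  have h : ∃ b : HalfDiagram n, b.word = a.word := ⟨a, rfl⟩
  rw [xiOfWord, dif_pos h, HalfDiagram.word_injective h.choose_spec]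

open Classical in
/-- The vector of the second basis that belongs to a word, built along one choice of boxes. -/
noncomputable def wordVec (n : ℕ) (f : ℕ → Bool) : U n :=
  if h : IsWord n f ∧ ∃ i, IsPeak f i then
    genOp q n h.2.choose (wordVec n (swapLetters f h.2.choose)) -
      ((mu q (wordHeight f h.2.choose) : ℝ) : ℂ) • wordVec n (swapLetters f h.2.choose)
  else xiOfWord n f
termination_by (levels n f).sum
decreasing_by all_goals exact h.2.choose_spec.sum_levels_lt h.1

theorem wordVec_word {a : HalfDiagram n} (no_peak : ∀ i, ¬ IsPeak a.word i) :
    wordVec q n a.word = xi a := by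
  rw [wordVec, dif_neg fun h => no_peak _ h.2.choose_spec, xiOfWord_word]

theorem IsPeak.wordVec_eq (h : IsPeak f i) (hf : IsWord n f) :
    wordVec q n f = genOp q n i (wordVec q n (swapLetters f i)) -
      ((mu q (wordHeight f i) : ℝ) : ℂ) • wordVec q n (swapLetters f i) := by
  revert i
  refine hf.box_induction (motive := fun f => ∀ {i}, IsPeak f i → wordVec q n f =
      genOp q n i (wordVec q n (swapLetters f i)) -
        ((mu q (wordHeight f i) : ℝ) : ℂ) • wordVec q n (swapLetters f i))
    (fun f _ no_peak i h => absurd h (no_peak i)) fun f _ hf _ ih i h => ?_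
  have exists_peak : IsWord n f ∧ ∃ i, IsPeak f i := ⟨hf, i, h⟩
  rw [wordVec, dif_pos exists_peak]
  have hj := exists_peak.2.choose_spec
  generalize exists_peak.2.choose = j at *
  rcases h.eq_or_apart hj with rfl | apart
  · rfl
  have comm : swapLetters (swapLetters f j) i =
      swapLetters (swapLetters f i) j :=
    apart.elim (fun hij => (swapLetters_comm hij).symm) swapLetters_comm
  have commute : Commute (genOp q n i) (genOp q n j) :=
    apart.elim (commute_genOp q) fun hji => (commute_genOp q hji).symm
  rw [ih _ (hj.isWord hf) (hj.sum_levels_lt hf) (hj.swapLetters h apart.symm),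
    ih _ (h.isWord hf) (h.sum_levels_lt hf) (h.swapLetters hj apart),
    h.wordHeight_swapLetters_of_ne (by omega), hj.wordHeight_swapLetters_of_ne (by omega), comm]
  simp only [map_sub, map_smul, smul_sub, ← Module.End.mul_apply]
  rw [commute.eq, smul_comm]
  abel

theorem IsWord.exists_flat (hf : IsWord n f) (no_peak : ∀ i, ¬ IsPeak f i) :
    ∃ r, ∃ hr : 2 * r ≤ n,
      f = flatWord r ∧ wordVec q n f = xi (HalfDiagram.flat n r hr) := by
  obtain ⟨r, hr, rfl⟩ := hf.exists_eq_flatWord no_peak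
  have word_eq := HalfDiagram.word_flat hr
  exact ⟨r, hr, rfl, by rw [← word_eq, wordVec_word q (word_eq.symm ▸ no_peak)]⟩

end WordVec

/-! ### Contracting peaks and slopes -/

section Slopes

variable {n : ℕ} (q : ℝ) {i j r s : ℕ} {f : ℕ → Bool}

theorem genOp_xi_flat_of_peak (hr : 2 * r ≤ n) (left : flatWord r i = true)
    (right : flatWord r (i + 1) = false) :
    genOp q n i (xi (HalfDiagram.flat n r hr)) = (q : ℂ) • xi (HalfDiagram.flat n r hr) :=
  (HalfDiagram.hasArch_of_word ((HalfDiagram.word_flat hr).symm ▸ left)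
    ((HalfDiagram.word_flat hr).symm ▸ right)).genOp_xi q

theorem genOp_xi_flat_of_slope (hr : 2 * r ≤ n) (slope : flatWord r i = flatWord r (i + 1)) :
    genOp q n i (xi (HalfDiagram.flat n r hr)) = 0 := by
  by_cases hi : i + 1 < n
  · have hri : 2 * r ≤ i := by grind [flatWord]
    rw [genOp_xi q hi, HalfDiagram.weight_flat_eq_zero hr q hi hri, Complex.ofReal_zero, zero_smul]
  · rw [genOp_of_not_lt q hi, LinearMap.zero_apply]

theorem genProd_xi_flat (hr : 2 * r ≤ n) (hs : s < r) (hn : 2 * s + 2 < n) :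
    genProd n q (2 * s + 2) (xi (HalfDiagram.flat n r hr)) = xi (HalfDiagram.flat n r hr) := by
  induction s with
  | zero => exact (HalfDiagram.hasArch_flat hr hs).genOp_genOp_succ_xi q hn
  | succ s ih =>
    rw [genProd_succ, genProd_succ, Module.End.mul_apply, Module.End.mul_apply,
      (HalfDiagram.hasArch_flat hr hs).genOp_genOp_succ_xi q hn]
    exact ih (by omega) (by omega)

theorem genOp_wordVec_of_wordHeight_eq_zero (hf : IsWord n f) (left : f i = true)
    (right : f (i + 1) = false) (height_eq : wordHeight f i = 0) :
    genOp q n i (wordVec q n f) = (q : ℂ) • wordVec q n f := by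
  refine hf.box_induction (motive := fun f => f i = true → f (i + 1) = false →
    wordHeight f i = 0 → genOp q n i (wordVec q n f) = (q : ℂ) • wordVec q n f)
    (fun f hf no_peak left right _ => ?_) (fun f j hf peak ih left right height_eq => ?_)
    left right height_eq
  · obtain ⟨r, hr, rfl, wordVec_eq⟩ := hf.exists_flat q no_peak
    rw [wordVec_eq, genOp_xi_flat_of_peak q hr left right]
  · have apart : i + 2 ≤ j ∨ j + 2 ≤ i := by grind [peak.left, peak.right, peak.one_le]
    have commute : Commute (genOp q n i) (genOp q n j) :=
      apart.elim (commute_genOp q) fun hji => (commute_genOp q hji).symm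
    have eigen := ih _ (peak.isWord hf) (peak.sum_levels_lt hf)
      (by rw [swapLetters_of_ne (by omega) (by omega), left])
      (by rw [swapLetters_of_ne (by omega) (by omega), right])
      (by rw [peak.wordHeight_swapLetters_of_ne (by omega), height_eq])
    rw [peak.wordVec_eq q hf, map_sub, map_smul, ← Module.End.mul_apply, commute.eq,
      Module.End.mul_apply, eigen, map_smul, smul_sub, smul_comm (q : ℂ) (Complex.ofReal _)]

/-- The recursion `μ_{k+1} (q - μ_k) = 1` holds up to the levels of a word, that is, no
denominator vanishes in the coefficients that occur in the vector of this word. -/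
def Admissible (n : ℕ) (f : ℕ → Bool) : Prop :=
  ∀ x ∈ levels n f, ∀ k < x, mu q (k + 1) * (q - mu q k) = 1

variable {q}

theorem Admissible.mu_succ_mul (h : Admissible q n f) (hf : IsWord n f) (peak : IsPeak f i)
    {k : ℕ} (hk : k ≤ wordHeight f i) : mu q (k + 1) * (q - mu q k) = 1 :=
  h _ (peak.levels_eq_cons hf ▸ Multiset.mem_cons_self _ _) k (by omega)

theorem Admissible.of_levels_eq_cons {g : ℕ → Bool} {x : ℕ} (h : Admissible q n f)
    (hf : IsWord n f) (peak : IsPeak f i) (hx : x ≤ wordHeight f i + 1)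
    (levels_eq : levels n g = x ::ₘ otherLevels n f i) : Admissible q n g := by
  intro y hy k hk
  rw [levels_eq, Multiset.mem_cons] at hy
  rcases hy with rfl | hy
  · exact h.mu_succ_mul hf peak (by omega)
  · exact h y (peak.levels_eq_cons hf ▸ Multiset.mem_cons_of_mem hy) k hk

protected theorem Admissible.swapLetters (h : Admissible q n f) (hf : IsWord n f)
    (peak : IsPeak f i) : Admissible q n (swapLetters f i) :=
  h.of_levels_eq_cons hf peak (by omega) (peak.levels_swapLetters hf)

theorem IsPeak.levels_moveToFront (h : IsPeak f i) (hf : IsWord n f) :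
    levels n (moveToFront (swapLetters f i) i) = 1 ::ₘ otherLevels n f i := by
  rw [h.isValley.levels_moveToFront (hf.lt h.right), h.otherLevels_swapLetters]

protected theorem Admissible.moveToFront (h : Admissible q n f) (hf : IsWord n f)
    (peak : IsPeak f i) : Admissible q n (moveToFront (swapLetters f i) i) :=
  h.of_levels_eq_cons hf peak (by omega) (peak.levels_moveToFront hf)

section Algebra

variable {R M : Type*} [CommRing R] [AddCommGroup M] [Module R M] {e e' : Module.End R M}
  {c μ μ' : R} {v : M}

theorem apply_sub_smul_eq_zero_of_eigenvector (braid : e * e' * e = e) (eigen : e v = c • v)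
    (hμ : μ * c = 1) : e (e' v - μ • v) = 0 := by
  have contract : e (e' v) = μ • e v := calc
    e (e' v) = μ • e (e' (c • v)) := by rw [map_smul, map_smul, smul_smul, hμ, one_smul]
    _ = μ • e v := by rw [← eigen]; exact congrArg (μ • ·) (LinearMap.congr_fun braid v)
  rw [map_sub, map_smul, contract, sub_self]

theorem apply_sub_smul_eq_zero_of_slope (square : e * e = c • e) (braid : e * e' * e = e)
    (slope : e' v = 0) (hμ : μ * (c - μ') = 1) :
    e (e' (e v - μ' • v) - μ • (e v - μ' • v)) = 0 := by
  have square_apply : e (e v) = c • e v := LinearMap.congr_fun square v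
  have braid_apply : e (e' (e v)) = e v := LinearMap.congr_fun braid v
  simp only [map_sub, map_smul, slope, smul_zero, sub_zero, square_apply, braid_apply]
  rw [← sub_smul, smul_smul, hμ, one_smul, sub_self]

end Algebra

theorem genOp_wordVec_of_adjacent_peak (hf : IsWord n f) (admissible : Admissible q n f)
    (peak : IsPeak f j) (braid : genOp q n i * genOp q n j * genOp q n i = genOp q n i)
    (left : swapLetters f j i = true) (right : swapLetters f j (i + 1) = false)
    (height_eq : wordHeight (swapLetters f j) i + 1 = wordHeight f j)
    (slope : IsPeak (swapLetters f j) i →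
      genOp q n j (wordVec q n (swapLetters (swapLetters f j) i)) = 0) :
    genOp q n i (wordVec q n f) = 0 := by
  have hf' := peak.isWord hf
  have mu_mul : ((mu q (wordHeight f j) : ℝ) : ℂ) *
      ((q : ℂ) - ((mu q (wordHeight (swapLetters f j) i) : ℝ) : ℂ)) = 1 := by
    have := admissible.mu_succ_mul hf peak (k := wordHeight (swapLetters f j) i) (by omega)
    rw [height_eq] at this
    exact_mod_cast this
  rw [peak.wordVec_eq q hf]
  rcases Nat.eq_zero_or_pos (wordHeight (swapLetters f j) i) with height_zero | height_pos
  · refine apply_sub_smul_eq_zero_of_eigenvector braid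
      (genOp_wordVec_of_wordHeight_eq_zero q hf' left right height_zero) ?_
    rwa [height_zero, mu, Complex.ofReal_zero, sub_zero] at mu_mul
  · have peak' : IsPeak (swapLetters f j) i := ⟨left, right, height_pos⟩
    rw [peak'.wordVec_eq q hf']
    exact apply_sub_smul_eq_zero_of_slope (genOp_mul_self q) braid (slope peak') mu_mul

theorem genOp_wordVec_slope (hf : IsWord n f) (admissible : Admissible q n f)
    (slope : f i = f (i + 1)) : genOp q n i (wordVec q n f) = 0 := by
  revert i
  refine hf.box_induction (motive := fun f => Admissible q n f → ∀ {i}, f i = f (i + 1) →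
    genOp q n i (wordVec q n f) = 0) (fun f hf no_peak _ i slope => ?_)
    (fun f j hf peak ih admissible i slope => ?_) admissible
  · obtain ⟨r, hr, rfl, wordVec_eq⟩ := hf.exists_flat q no_peak
    rw [wordVec_eq, genOp_xi_flat_of_slope q hr slope]
  have hf' := peak.isWord hf
  have lt := peak.sum_levels_lt hf
  have admissible' := admissible.swapLetters hf peak
  have ih_twice (peak' : IsPeak (swapLetters f j) i) := ih _ (peak'.isWord hf')
    ((peak'.sum_levels_lt hf').trans lt) (admissible'.swapLetters hf' peak') (i := j)
  have left := peak.left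
  have right := peak.right
  obtain rfl | rfl | far : j = i + 1 ∨ i = j + 1 ∨ i + 2 ≤ j ∨ j + 2 ≤ i := by grind
  · refine genOp_wordVec_of_adjacent_peak hf admissible peak
      (genOp_mul_genOp_succ_mul_genOp q (hf.lt right)) (by grind [swapLetters])
      (by grind [swapLetters]) ?_ fun peak' => ih_twice peak' (by grind [swapLetters])
    rw [wordHeight_swapLetters_of_le (by omega), wordHeight_succ_of_true (slope.trans left)]
  · refine genOp_wordVec_of_adjacent_peak hf admissible peak
      (genOp_succ_mul_genOp_mul_genOp_succ q) (by grind [swapLetters])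
      (by grind [swapLetters]) ?_ fun peak' => ih_twice peak' (by grind [swapLetters])
    rw [peak.wordHeight_swapLetters_succ, Nat.sub_add_cancel peak.one_le]
  · have commute : Commute (genOp q n i) (genOp q n j) :=
      far.elim (commute_genOp q) fun hji => (commute_genOp q hji).symm
    have slope' := ih _ hf' lt admissible' (i := i) (by
      rw [swapLetters_of_ne (by omega) (by omega), swapLetters_of_ne (by omega) (by omega), slope])
    rw [peak.wordVec_eq q hf, map_sub, map_smul, ← Module.End.mul_apply, commute.eq,
      Module.End.mul_apply, slope', map_zero, smul_zero, sub_zero]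

end Slopes

/-! ### Contracting minima -/

section Valleys

variable {n : ℕ} {q : ℝ} {i j : ℕ} {f : ℕ → Bool}

theorem moveToFront_swapLetters_of_ge (h : i + 2 ≤ j) :
    moveToFront (swapLetters f j) i = swapLetters (moveToFront f i) j := by
  ext k
  simp only [moveToFront, swapLetters]
  grind

theorem moveToFront_swapLetters_of_le (h : j + 2 ≤ i) :
    moveToFront (swapLetters f j) i = swapLetters (moveToFront f i) (j + 2) := by
  ext k
  simp only [moveToFront, swapLetters]
  grind

theorem moveToFront_swapLetters_succ (h : f i = f (i + 2)) :
    moveToFront (swapLetters f (i + 1)) (i + 1) = moveToFront f i := by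
  ext k
  simp only [moveToFront, swapLetters]
  grind

theorem moveToFront_swapLetters_pred (h : f i = f (i + 2)) :
    moveToFront (swapLetters f i) i = moveToFront f (i + 1) := by
  ext k
  simp only [moveToFront, swapLetters]
  grind

theorem IsPeak.moveToFront_of_ge (h : IsPeak f j) (valley : IsValley f i) (hij : i + 2 ≤ j) :
    IsPeak (moveToFront f i) j where
  left := by grind [moveToFront, h.left]
  right := by grind [moveToFront, h.right]
  one_le := (valley.wordHeight_moveToFront_of_ge hij).symm ▸ h.one_le

theorem IsPeak.moveToFront_of_le (h : IsPeak f j) (hji : j + 2 ≤ i) :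
    IsPeak (moveToFront f i) (j + 2) where
  left := by grind [moveToFront, h.left]
  right := by grind [moveToFront, h.right]
  one_le := (wordHeight_moveToFront_of_le (f := f) (by omega : j ≤ i)).symm ▸ h.one_le

theorem IsPeak.isValley_swapLetters (h : IsPeak f j) (valley : IsValley f i)
    (far : i + 2 ≤ j ∨ j + 2 ≤ i) : IsValley (swapLetters f j) i where
  left := (swapLetters_of_ne (by omega) (by omega)).trans valley.left
  right := (swapLetters_of_ne (by omega) (by omega)).trans valley.right
  one_le := (h.wordHeight_swapLetters_of_ne (k := i) (by omega)).symm ▸ valley.one_le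

theorem genProd_wordVec_of_succ_peak (hf : IsWord n f) (admissible : Admissible q n f)
    (valley : IsValley f i) (peak : IsPeak f (i + 1))
    (ih : genProd n q (i + 2) (wordVec q n (swapLetters f (i + 1))) =
      wordVec q n (moveToFront (swapLetters f (i + 1)) (i + 1))) :
    genProd n q (i + 1) (wordVec q n f) = wordVec q n (moveToFront f i) := by
  have slope : genOp q n i (wordVec q n (swapLetters f (i + 1))) = 0 :=
    genOp_wordVec_slope (peak.isWord hf) (admissible.swapLetters hf peak)
      (by grind [swapLetters, valley.left, peak.right])
  rw [moveToFront_swapLetters_succ (valley.left.trans peak.right.symm)] at ih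
  rw [peak.wordVec_eq q hf, map_sub, map_smul, ← Module.End.mul_apply, ← genProd_succ, ih,
    genProd_succ, Module.End.mul_apply, slope, map_zero, smul_zero, sub_zero]

theorem genProd_wordVec_of_pred_peak (hf : IsWord n f) (admissible : Admissible q n f)
    (valley : IsValley f (i + 1)) (hi : i + 2 < n) (peak : IsPeak f i)
    (ih : genProd n q (i + 1) (wordVec q n (swapLetters f i)) =
      wordVec q n (moveToFront (swapLetters f i) i)) :
    genProd n q (i + 2) (wordVec q n f) = wordVec q n (moveToFront f (i + 1)) := by
  have slope : genOp q n (i + 1) (wordVec q n (swapLetters f i)) = 0 :=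
    genOp_wordVec_slope (peak.isWord hf) (admissible.swapLetters hf peak)
      (by grind [swapLetters, valley.right, peak.left])
  rw [moveToFront_swapLetters_pred (peak.left.trans valley.right.symm)] at ih
  rw [peak.wordVec_eq q hf, map_sub, map_smul, ← Module.End.mul_apply,
    genProd_add_two_mul_genOp q hi, ih, genProd_succ, Module.End.mul_apply, slope, map_zero,
    smul_zero, sub_zero]

theorem genProd_wordVec_of_far_peak (hf : IsWord n f) (valley : IsValley f i) (hi : i + 1 < n)
    (peak : IsPeak f j) (far : i + 2 ≤ j ∨ j + 2 ≤ i)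
    (ih : genProd n q (i + 1) (wordVec q n (swapLetters f j)) =
      wordVec q n (moveToFront (swapLetters f j) i)) :
    genProd n q (i + 1) (wordVec q n f) = wordVec q n (moveToFront f i) := by
  have isWord := valley.isWord_moveToFront hf hi
  rw [peak.wordVec_eq q hf, map_sub, map_smul, ← Module.End.mul_apply]
  rcases far with hij | hji
  · rw [(commute_genProd_genOp q hij).eq, Module.End.mul_apply, ih,
      moveToFront_swapLetters_of_ge hij, (peak.moveToFront_of_ge valley hij).wordVec_eq q isWord,
      valley.wordHeight_moveToFront_of_ge hij]
  · rw [genProd_mul_genOp q hji hi, Module.End.mul_apply, ih,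
      moveToFront_swapLetters_of_le hji, (peak.moveToFront_of_le hji).wordVec_eq q isWord,
      wordHeight_moveToFront_of_le (by omega)]

theorem genProd_wordVec_of_isValley (hf : IsWord n f) (admissible : Admissible q n f)
    (valley : IsValley f i) (hi : i + 1 < n) :
    genProd n q (i + 1) (wordVec q n f) = wordVec q n (moveToFront f i) := by
  revert i
  refine hf.box_induction (motive := fun f => Admissible q n f → ∀ {i}, IsValley f i →
    i + 1 < n → genProd n q (i + 1) (wordVec q n f) = wordVec q n (moveToFront f i))
    (fun f hf no_peak _ i valley hi => ?_) (fun f j hf peak ih admissible i valley hi => ?_)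
    admissible
  · obtain ⟨r, hr, rfl, wordVec_eq⟩ := hf.exists_flat q no_peak
    obtain ⟨s, hs, rfl⟩ : ∃ s < r, i = 2 * s + 1 :=
      ⟨i / 2, by grind [flatWord, valley.left], by grind [flatWord, valley.left]⟩
    rw [moveToFront_flatWord hs, wordVec_eq, genProd_xi_flat q hr hs hi]
  have ih {i : ℕ} := ih _ (peak.isWord hf) (peak.sum_levels_lt hf)
    (admissible.swapLetters hf peak) (i := i)
  have peak_valley := peak.isValley
  obtain rfl | rfl | far : j = i + 1 ∨ i = j + 1 ∨ i + 2 ≤ j ∨ j + 2 ≤ i := by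
    grind [valley.left, peak.left]
  · exact genProd_wordVec_of_succ_peak hf admissible valley peak
      (ih peak_valley (hf.lt peak.right))
  · exact genProd_wordVec_of_pred_peak hf admissible valley hi peak (ih peak_valley (by omega))
  · exact genProd_wordVec_of_far_peak hf valley hi peak far
      (ih (peak.isValley_swapLetters valley far) hi)

end Valleys

/-! ### The norms of the second basis -/

section Norm

variable {n : ℕ} {q : ℝ} {i : ℕ} {f : ℕ → Bool}

theorem formMap_genOp_sub_smul_self {v : U n} {m m' A : ℝ}
    (hm : m ≠ 0) (hm' : m' * (q - m) = 1) (norm : formMap q v v = ((A / m : ℝ) : ℂ))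
    (contraction : formMap q (genOp q n i v) v = A) :
    formMap q (genOp q n i v - (m : ℂ) • v) (genOp q n i v - (m : ℂ) • v) =
      ((A / m' : ℝ) : ℂ) := by
  have square : formMap q (genOp q n i v) (genOp q n i v) = q * A := by
    rw [formMap_genOp_self, contraction]
  have contraction' : formMap q v (genOp q n i v) = A := by rw [← formMap_genOp, contraction]
  have inv_eq : m'⁻¹ = q - m := inv_eq_of_mul_eq_one_right hm'
  simp only [map_sub, LinearMap.sub_apply, map_smul, LinearMap.smul_apply, map_smulₛₗ,
    smul_eq_mul, Complex.conj_ofReal, norm, contraction, contraction', square]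
  rw [div_eq_mul_inv A m', inv_eq]
  push_cast
  field_simp [Complex.ofReal_ne_zero.2 hm]
  ring

theorem Admissible.mu_one_mul (h : Admissible q n f) {x : ℕ} (hx : x ∈ levels n f)
    (x_pos : 0 < x) : mu q 1 * q = 1 := by
  simpa only [zero_add, mu, sub_zero] using h x hx 0 x_pos

theorem formMap_wordVec_self_of_no_peak (hf : IsWord n f) (admissible : Admissible q n f)
    (no_peak : ∀ i, ¬ IsPeak f i) :
    formMap q (wordVec q n f) (wordVec q n f) =
      ((((levels n f).map (mu q)).prod⁻¹ : ℝ) : ℂ) := by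
  obtain ⟨a, rfl⟩ := HalfDiagram.exists_word_eq hf
  have levels_one := (forall_mem_levels_eq_one_iff hf).2 no_peak
  rw [wordVec_word q no_peak, formMap_xi, formBasis_self, ← a.card_levels_word,
    Multiset.eq_replicate_card.2 levels_one, Multiset.map_replicate, Multiset.prod_replicate,
    Multiset.card_replicate]
  rcases Nat.eq_zero_or_pos (levels n a.word).card with card_zero | card_pos
  · rw [card_zero, pow_zero, pow_zero, inv_one]
  · obtain ⟨x, hx⟩ := Multiset.card_pos_iff_exists_mem.1 card_pos
    have mu_one := admissible.mu_one_mul hx (by rw [levels_one x hx]; exact one_pos)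
    rw [← inv_pow, inv_eq_of_mul_eq_one_right mu_one]

theorem formMap_genOp_wordVec_swapLetters (hf : IsWord n f) (admissible : Admissible q n f)
    (peak : IsPeak f i)
    (ih : formMap q (wordVec q n (moveToFront (swapLetters f i) i))
        (wordVec q n (moveToFront (swapLetters f i) i)) =
      ((((levels n (moveToFront (swapLetters f i) i)).map (mu q)).prod⁻¹ : ℝ) : ℂ)) :
    formMap q (genOp q n i (wordVec q n (swapLetters f i))) (wordVec q n (swapLetters f i)) =
      ((((otherLevels n f i).map (mu q)).prod⁻¹ : ℝ) : ℂ) := by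
  have hi : i + 1 < n := hf.lt peak.right
  have mu_one : mu q 1 * q = 1 :=
    admissible.mu_one_mul (hf.wordHeight_mem_levels peak.right) (hf.one_le _ peak.right)
  have hq : (q : ℂ) ≠ 0 := Complex.ofReal_ne_zero.2 (right_ne_zero_of_mul_eq_one mu_one)
  refine mul_left_cancel₀ hq ?_
  rw [← formMap_genProd_self q hi, genProd_wordVec_of_isValley (peak.isWord hf)
    (admissible.swapLetters hf peak) peak.isValley hi, ih, peak.levels_moveToFront hf,
    Multiset.map_cons, Multiset.prod_cons, mul_inv, inv_eq_of_mul_eq_one_right mu_one,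
    Complex.ofReal_mul]

theorem formMap_wordVec_self (hf : IsWord n f) (admissible : Admissible q n f) :
    formMap q (wordVec q n f) (wordVec q n f) =
      ((((levels n f).map (mu q)).prod⁻¹ : ℝ) : ℂ) := by
  refine hf.box_induction (motive := fun f => Admissible q n f →
    formMap q (wordVec q n f) (wordVec q n f) = ((((levels n f).map (mu q)).prod⁻¹ : ℝ) : ℂ))
    (fun f hf no_peak admissible => formMap_wordVec_self_of_no_peak hf admissible no_peak)
    (fun f i hf peak ih admissible => ?_) admissible
  have hi : i + 1 < n := hf.lt peak.right
  have norm := ih _ (peak.isWord hf) (peak.sum_levels_lt hf) (admissible.swapLetters hf peak)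
  have norm_front := ih _ (peak.isValley.isWord_moveToFront (peak.isWord hf) hi)
    (by
      rw [peak.levels_moveToFront hf, peak.levels_eq_cons hf, Multiset.sum_cons, Multiset.sum_cons]
      have := peak.one_le
      omega)
    (admissible.moveToFront hf peak)
  have mu_pred := admissible.mu_succ_mul hf peak (k := wordHeight f i - 1) (Nat.sub_le _ _)
  rw [Nat.sub_add_cancel peak.one_le] at mu_pred
  rw [peak.levels_swapLetters hf, Multiset.map_cons, Multiset.prod_cons, mul_inv_rev,
    ← div_eq_mul_inv] at norm
  rw [peak.wordVec_eq q hf, peak.levels_eq_cons hf, Multiset.map_cons, Multiset.prod_cons,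
    mul_inv_rev, ← div_eq_mul_inv]
  exact formMap_genOp_sub_smul_self (left_ne_zero_of_mul_eq_one mu_pred)
    (admissible.mu_succ_mul hf peak le_rfl) norm
    (formMap_genOp_wordVec_swapLetters hf admissible peak norm_front)

end Norm

/-! ### Chebyshev polynomials -/

section Chebyshev

variable (q : ℝ)

/-- The tridiagonal matrix whose determinant is `Delta k q`. -/
def chebyshevMatrix (k : ℕ) : Matrix (Fin k) (Fin k) ℝ :=
  Matrix.of fun i j => if i = j then q else if i.1 + 1 = j.1 ∨ j.1 + 1 = i.1 then 1 else 0

theorem Delta_zero : Delta 0 q = 1 := by simp [Delta]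

theorem Delta_one : Delta 1 q = q := by simp [Delta]

theorem det_chebyshevMatrix_submatrix (k : ℕ) :
    ((chebyshevMatrix q (k + 2)).submatrix Fin.succ (Fin.succAbove (Fin.succ 0))).det =
      Delta k q := by
  have minor_eq : ((chebyshevMatrix q (k + 2)).submatrix Fin.succ
      (Fin.succAbove (Fin.succ 0))).submatrix (Fin.succAbove 0) Fin.succ =
        chebyshevMatrix q k := by
    ext i j
    simp [chebyshevMatrix, Fin.ext_iff, Fin.succAbove]
  rw [Matrix.det_succ_column_zero, Fin.sum_univ_succ,
    Finset.sum_eq_zero fun j _ => by simp [chebyshevMatrix, Fin.ext_iff, Fin.succAbove], add_zero,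
    minor_eq, ← show Delta k q = (chebyshevMatrix q k).det from rfl]
  simp [chebyshevMatrix, Fin.ext_iff, Fin.succAbove]

theorem Delta_add_two (k : ℕ) : Delta (k + 2) q = q * Delta (k + 1) q - Delta k q := by
  have minor_eq : (chebyshevMatrix q (k + 2)).submatrix Fin.succ (Fin.succAbove 0) =
      chebyshevMatrix q (k + 1) := by
    ext i j
    simp [chebyshevMatrix]
  rw [show Delta (k + 2) q = (chebyshevMatrix q (k + 2)).det from rfl, Matrix.det_succ_row_zero,
    Fin.sum_univ_succ, Fin.sum_univ_succ,
    Finset.sum_eq_zero fun j _ => by simp [chebyshevMatrix, Fin.ext_iff], add_zero, minor_eq,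
    det_chebyshevMatrix_submatrix,
    ← show Delta (k + 1) q = (chebyshevMatrix q (k + 1)).det from rfl]
  simp [chebyshevMatrix]
  ring

variable {q}

theorem mu_succ_mul {x : ℕ} (h : ∀ k, 1 ≤ k → k ≤ x → Delta k q ≠ 0) {k : ℕ} (hk : k < x) :
    mu q (k + 1) * (q - mu q k) = 1 := by
  have succ_ne := h (k + 1) (by omega) hk
  cases k with
  | zero =>
    rw [zero_add, Delta_one] at succ_ne
    rw [mu, mu, zero_add, Delta_zero, Delta_one, sub_zero, one_div, inv_mul_cancel₀ succ_ne]
  | succ k =>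
    have ne := h (k + 1) (by omega) hk.le
    rw [mu, mu]
    field_simp
    rw [Delta_add_two]
    ring

end Chebyshev

/-! ### The second basis -/

section SecondBasis

variable {n : ℕ} {q : ℝ} {a : HalfDiagram n}

theorem admissible_word
    (h : ∀ x ∈ a.restrictedSequence, ∀ k : ℕ, 1 ≤ k → k ≤ x → Delta k q ≠ 0) :
    Admissible q n a.word := by
  intro x hx k hk
  rw [← a.coe_restrictedSequence, Multiset.mem_coe] at hx
  exact mu_succ_mul (h x hx) hk

theorem SecondBasis.eq_wordVec {v : U n} (h : SecondBasis q a v) : v = wordVec q n a.word := by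
  induction h with
  | minimal a minimal => rw [wordVec_word q (a.isMinimal_iff.1 minimal)]
  | box i hi a b v box _ ih =>
    obtain ⟨peak, word_eq⟩ := (HalfDiagram.isBoxAddition_iff hi).1 box
    have height_eq : a.height (i + 1) + 1 = wordHeight b.word i := by
      rw [a.height_eq hi.le, word_eq, peak.wordHeight_swapLetters_succ,
        Nat.sub_add_cancel peak.one_le]
    rw [peak.wordVec_eq q b.isWord_word, ← word_eq, ← ih, height_eq, genOp_of_lt q hi]

theorem secondBasis_wordVec (q : ℝ) (a : HalfDiagram n) : SecondBasis q a (wordVec q n a.word) := by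
  refine a.isWord_word.box_induction
    (motive := fun f => ∀ a : HalfDiagram n, a.word = f → SecondBasis q a (wordVec q n f))
    ?_ ?_ a rfl
  · rintro _ - no_peak a rfl
    rw [wordVec_word q no_peak]
    exact .minimal a (a.isMinimal_iff.2 no_peak)
  · rintro _ i hf peak ih a rfl
    obtain ⟨b, word_eq⟩ := HalfDiagram.exists_word_eq (peak.isWord hf)
    have box := SecondBasis.box i (hf.lt peak.right) b a _
      ((HalfDiagram.isBoxAddition_iff _).2 ⟨peak, word_eq⟩)
      (ih _ (peak.isWord hf) (peak.sum_levels_lt hf) b word_eq)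
    rwa [← box.eq_wordVec]

theorem xiPrime_eq_wordVec (q : ℝ) (a : HalfDiagram n) : xiPrime q a = wordVec q n a.word :=
  SecondBasis.eq_wordVec (Classical.epsilon_spec ⟨_, secondBasis_wordVec q a⟩)

end SecondBasis

end TemperleyLieb

theorem mainTheorem2_general (n : ℕ) (q : ℝ) (a : TemperleyLieb.HalfDiagram n)
    (hΔ : ∀ x ∈ a.restrictedSequence, ∀ k : ℕ, 1 ≤ k → k ≤ x → TemperleyLieb.Delta k q ≠ 0) :
    (∃! v : TemperleyLieb.U n, TemperleyLieb.SecondBasis q a v) ∧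
      TemperleyLieb.form q (TemperleyLieb.xiPrime q a) (TemperleyLieb.xiPrime q a) =
        ((1 / (a.restrictedSequence.map (TemperleyLieb.mu q)).prod : ℝ) : ℂ) := by
  refine ⟨⟨_, TemperleyLieb.secondBasis_wordVec q a, fun v hv => hv.eq_wordVec⟩, ?_⟩
  rw [TemperleyLieb.xiPrime_eq_wordVec, ← TemperleyLieb.formMap_apply,
    TemperleyLieb.formMap_wordVec_self a.isWord_word (TemperleyLieb.admissible_word hΔ),
    ← a.coe_restrictedSequence, Multiset.map_coe, Multiset.prod_coe, one_div]

theorem mainTheorem2 (n : ℕ) (q : ℝ) (hq : 0 < q) (a : TemperleyLieb.HalfDiagram n)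
    (hΔ : ∀ x ∈ a.restrictedSequence, ∀ k : ℕ, 1 ≤ k → k ≤ x → TemperleyLieb.Delta k q ≠ 0) :
    (∃! v : TemperleyLieb.U n, TemperleyLieb.SecondBasis q a v) ∧
      TemperleyLieb.form q (TemperleyLieb.xiPrime q a) (TemperleyLieb.xiPrime q a) =
        ((1 / (a.restrictedSequence.map (TemperleyLieb.mu q)).prod : ℝ) : ℂ) :=
  mainTheorem2_general n q a hΔ
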